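/- **Setting.** A simple stochastic game (SSG) is a finite directed graph whose vertex set is partitioned into MAX vertices, MIN vertices, random vertices and at least one sink; every vertex has an out-neighbour, the only arc out of a sink is a loop, each random vertex $x$ carries a probability distribution whose support is the out-neighbourhood of $x$, and each sink $s$ has a value $\mathrm{Val}(s)\in[0,1]$. It is a $q$-SSG if it has exactly two sinks, of values $0$ and $1$, and the probabilities at each random vertex $x$ are integer multiples of $1/q_x$ for some positive integer $q_x\le q$. The game need not be stopping. Strategies are positional; $v_{\sigma,\tau}(x)$ is the expected value of the sink reached by the play from $x$ under $(\sigma,\tau)$ (value $0$ if no sink is reached), and $v_\sigma=\min_\tau v_{\sigma,\tau}$ is attained by the best responses $\tau$ to $\sigma$. For a set $A$ of arcs, $G[A,\sigma]$ is the game in which each arc $(x,y)\in A$ with $x$ not a sink is redirected to a new sink of value $v_\sigma(y)$. Write $\sigma'\succ\sigma$ in a game if $v_{\sigma'}\ge v_\sigma$, $v_{\sigma'}\neq v_\sigma$, and $\sigma'(x)=\sigma(x)$ at every MAX vertex $x$ with $v_{\sigma'}(x)=v_\sigma(x)$. The generic strategy improvement algorithm (GSIA) starts from any MAX strategy $\sigma$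 and, as long as $\sigma$ with a best response is not a pair of optimal strategies of $G$, chooses any set $A$ of arcs, finds any $\sigma'$ with $\sigma'\succ\sigma$ in $G[A,\sigma]$, and replaces $\sigma$ by $\sigma'$. **Cost model.** Let $n$ be the number of MAX vertices and $r$ the number of random vertices. Finding $\sigma'$ (with the choice of $A$ and the construction of $G[A,\sigma]$) costs $C_2(n,r,q)$. Computing $v_\sigma$ from scratch costs $C_1(n,q^r)$; this is done for the initial strategy, and for every new strategy if $r\ge n$. If $r<n$, the values of the new strategy $\sigma'$ are computed as follows. A candidate response to $\sigma'$ is read off from the order of the values of $v_\sigma$ on random vertices and sinks, as a best response to $\sigma'$ in a game where plays stop on entering a random vertex, with stopping values in $[0,1]$ in that same order (sinks keep their values); this and the optimality test cost $c_0(r\log r+n)$. The values of $\sigma'$ against the candidate are computed (a linear system of dimension $r$) at cost $c_0\,C_1(r,q^r)$. If the candidate is not a best response to $\sigma'$, then $v_{\sigma'}$ is computed from scratch at additional cost $C_1(n,q^r)$. The cost of an execution is the sum of these costs. **Theorem.** Let $c_0,c,\kappa>0$. There is a constant $K>0$, depending only on $c_0,c,\kappa$, with the following property. Let $C_1$ and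 $C_2$ be real-valued cost functions such that $C_1(m,p)$ grows at least quadratically in $m$, that is, $m^2\le\kappa\, C_1(m,p)$ and $C_1(a,p)/a^2\le\kappa\, C_1(b,p)/b^2$ for all $m,p\ge1$ and $1\le a\le b$, and such that $C_2(n,r,q)\le c\,C_1(n,q^r)\,r/n$ for all $n,r,q\ge1$. Let $q\ge1$ and let $G$ be a $q$-SSG with $n\ge1$ MAX vertices and $r\ge1$ random vertices. Then: 1. Every execution of GSIA on $G$, over any number of rounds, complete or not, costs at most $K\,r\,q^r\,C_1(n,q^r)$. 2. Let $\sigma'\succ\sigma$ in $G[A,\sigma]$ for some set $A$ of arcs. If a strict comparison between the values of two random vertices $x,y$ is lost, that is, $v_\sigma(x)<v_\sigma(y)$ but $v_{\sigma'}(x)\ge v_{\sigma'}(y)$, then $v_{\sigma'}(x)-v_\sigma(x)\ge q^{-r}$. -/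

import Mathlib

universe u

/-- The four kinds of vertices of a simple stochastic game. -/
inductive VertexKind where
  | maxV
  | minV
  | random
  | sink

/-- A simple stochastic game on the vertex set `V`. The fields `prob` and `val` are only
meaningful at random vertices and at sinks respectively. -/
structure SSG (V : Type u) where
  /-- the partition of the vertex set -/
  kind : V → VertexKind
  /-- the outneighbourhood of a vertex -/
  succ : V → Set V
  succ_nonempty : ∀ x, (succ x).Nonempty
  succ_sink : ∀ x, kind x = .sink → succ x = {x}
  exists_sink : ∃ x, kind x = .sink
  /-- the law of the vertex that follows a random vertex -/
  prob : V → PMF V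
  support_prob : ∀ x, kind x = .random → (prob x).support = succ x
  /-- the value of a sink -/
  val : V → ℝ
  val_mem : ∀ x, kind x = .sink → val x ∈ Set.Icc (0 : ℝ) 1

namespace SSG

open MeasureTheory ProbabilityTheory

variable {V : Type u}

/-- The set of arcs of the game. -/
def arcs (G : SSG V) : Set (V × V) := {e | e.2 ∈ G.succ e.1}

/-- The number of MAX vertices. -/
noncomputable def numMax (G : SSG V) : ℕ := Nat.card {x // G.kind x = .maxV}

/-- The number of random vertices. -/
noncomputable def numRandom (G : SSG V) : ℕ := Nat.card {x // G.kind x = .random}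

/-- A `q`-SSG: there are exactly two sinks, of values `0` and `1`, and the law at each random
vertex consists of multiples of `1 / qx` for some positive integer `qx ≤ q`. -/
def IsQSSG (G : SSG V) (q : ℕ) : Prop :=
  (∃ s₀ s₁, G.val s₀ = 0 ∧ G.val s₁ = 1 ∧ ∀ x, G.kind x = .sink ↔ (x = s₀ ∨ x = s₁)) ∧
  ∀ x, G.kind x = .random →
    ∃ qx : ℕ, 0 < qx ∧ qx ≤ q ∧ ∃ l : V → ℕ, ∀ y, (G.prob x y).toReal = (l y : ℝ) / (qx : ℝ)

/-- Positional strategies of MAX. -/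
abbrev MaxStrategy (G : SSG V) : Type u :=
  (x : {x // G.kind x = .maxV}) → {y // y ∈ G.succ x.1}

/-- Positional strategies of MIN. -/
abbrev MinStrategy (G : SSG V) : Type u :=
  (x : {x // G.kind x = .minV}) → {y // y ∈ G.succ x.1}

/-! ### Plays and values -/

/-- The law of the next vertex when the token is at `x`. -/
noncomputable def step (G : SSG V) (σ : G.MaxStrategy) (τ : G.MinStrategy) (x : V) : PMF V :=
  match h : G.kind x with
  | .maxV => PMF.pure (σ ⟨x, h⟩).1
  | .minV => PMF.pure (τ ⟨x, h⟩).1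
  | .random => G.prob x
  | .sink => PMF.pure x

open Classical in
/-- The value of a play: the value of the (first) sink that it reaches, and `0` if it
reaches none. -/
noncomputable def playValue (G : SSG V) (X : ℕ → V) : ℝ :=
  if h : ∃ t, G.kind (X t) = .sink then G.val (X (Nat.find h)) else 0

/-- The transition kernel at time `t`: it maps a history `h = (x_0, …, x_t)` to the law of the
next vertex. The finite vertex set carries the discrete `σ`-algebra. -/
noncomputable def stepKernel (G : SSG V) (σ : G.MaxStrategy) (τ : G.MinStrategy) (t : ℕ) :
    letI : MeasurableSpace V := ⊤
    Kernel ((i : Finset.Iic t) → (fun _ : ℕ => V) i) V :=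
  letI : MeasurableSpace V := ⊤
  Kernel.comap ⟨fun x => (G.step σ τ x).toMeasure, measurable_from_top⟩
    (fun h : (i : Finset.Iic t) → (fun _ : ℕ => V) i => h ⟨t, Finset.mem_Iic.2 le_rfl⟩)
    (measurable_pi_apply _)

instance (G : SSG V) (σ : G.MaxStrategy) (τ : G.MinStrategy) (t : ℕ) :
    letI : MeasurableSpace V := ⊤
    IsMarkovKernel (G.stepKernel σ τ t) := by
  let : MeasurableSpace V := ⊤
  refine ⟨fun h => ?_⟩
  simp only [stepKernel, Kernel.comap_apply]
  exact PMF.toMeasure.isProbabilityMeasure _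

/-- The law of the random play that starts at `x`, when the players follow `σ` and `τ`. -/
noncomputable def playMeasure (G : SSG V) (σ : G.MaxStrategy) (τ : G.MinStrategy) (x : V) :
    letI : MeasurableSpace V := ⊤
    Measure (ℕ → V) :=
  letI : MeasurableSpace V := ⊤
  Kernel.traj (X := fun _ : ℕ => V) (G.stepKernel σ τ) 0 (fun _ => x)

/-- `v_{σ,τ}(x)`: the expected value of the random play that starts at `x`. -/
noncomputable def value (G : SSG V) (σ : G.MaxStrategy) (τ : G.MinStrategy) (x : V) : ℝ :=
  letI : MeasurableSpace V := ⊤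
  ∫ X, G.playValue X ∂(G.playMeasure σ τ x)

/-- `τ` is a best response to the MAX strategy `σ`. -/
def IsBestResponse (G : SSG V) (σ : G.MaxStrategy) (τ : G.MinStrategy) : Prop :=
  ∀ τ' x, G.value σ τ x ≤ G.value σ τ' x

/-- `σ` is a best response to the MIN strategy `τ`. -/
def IsMaxBestResponse (G : SSG V) (σ : G.MaxStrategy) (τ : G.MinStrategy) : Prop :=
  ∀ σ' x, G.value σ' τ x ≤ G.value σ τ x

/-- `(σ, τ)` is a pair of optimal strategies: they are best responses to each other. -/
def IsOptimalPair (G : SSG V) (σ : G.MaxStrategy) (τ : G.MinStrategy) : Prop :=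
  G.IsBestResponse σ τ ∧ G.IsMaxBestResponse σ τ

/-- The value vector `v_σ` of a MAX strategy: its value against a best response of MIN. -/
noncomputable def strategyValue (G : SSG V) (σ : G.MaxStrategy) (x : V) : ℝ :=
  ⨅ τ : G.MinStrategy, G.value σ τ x

/-- The strict improvement order: `σ'` is better than `σ` (the value vectors satisfy `≤` at all
vertices and `<` at some vertex), and `σ'` agrees with `σ` at each MAX vertex whose value is the
same for both. -/
def StronglyImproves (G : SSG V) (σ' σ : G.MaxStrategy) : Prop :=
  G.strategyValue σ < G.strategyValue σ' ∧
    ∀ x : {x // G.kind x = .maxV},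
      G.strategyValue σ' x.1 = G.strategyValue σ x.1 → σ' x = σ x

instance (G : SSG V) : Nonempty G.MinStrategy :=
  ⟨fun x => ⟨(G.succ_nonempty x.1).some, (G.succ_nonempty x.1).some_mem⟩⟩

theorem playValue_mem (G : SSG V) (X : ℕ → V) : G.playValue X ∈ Set.Icc (0 : ℝ) 1 := by
  classical
  unfold playValue
  split_ifs with h
  · exact G.val_mem _ (Nat.find_spec h)
  · simp

theorem value_mem (G : SSG V) (σ : G.MaxStrategy) (τ : G.MinStrategy) (x : V) :
    G.value σ τ x ∈ Set.Icc (0 : ℝ) 1 := by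
  let : MeasurableSpace V := ⊤
  have hP : IsProbabilityMeasure (G.playMeasure σ τ x) := by
    unfold playMeasure
    infer_instance
  unfold value
  refine ⟨integral_nonneg fun X => (G.playValue_mem X).1, ?_⟩
  by_cases hi : Integrable (fun X => G.playValue X) (G.playMeasure σ τ x)
  · calc ∫ X, G.playValue X ∂(G.playMeasure σ τ x)
        ≤ ∫ _, (1 : ℝ) ∂(G.playMeasure σ τ x) :=
          integral_mono hi (integrable_const _) fun X => (G.playValue_mem X).2
      _ = 1 := by simp
  · rw [integral_undef hi]
    exact zero_le_one

theorem strategyValue_mem (G : SSG V) (σ : G.MaxStrategy) (x : V) :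
    G.strategyValue σ x ∈ Set.Icc (0 : ℝ) 1 := by
  refine ⟨Real.iInf_nonneg fun τ => (G.value_mem σ τ x).1, ?_⟩
  obtain ⟨τ⟩ : Nonempty G.MinStrategy := inferInstance
  refine (ciInf_le ⟨0, ?_⟩ τ).trans (G.value_mem σ τ x).2
  rintro _ ⟨τ', rfl⟩
  exact (G.value_mem σ τ' x).1

/-! ### The transformed game -/

open Classical in
/-- The new end point of an arc from `x` to `y` when the arcs of `A` are redirected to new
sinks. -/
noncomputable def redirect (A : Set (V × V)) (x y : V) : V ⊕ A :=
  if h : (x, y) ∈ A then Sum.inr ⟨(x, y), h⟩ else Sum.inl y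

/-- The game `G[A, f]`: each arc `e ∈ A` is redirected to a new sink of value `f e`. The loops
at the sinks of `G` stay. -/
noncomputable def fix (G : SSG V) (A : Set (V × V)) (f : A → Set.Icc (0 : ℝ) 1) :
    SSG (V ⊕ A) where
  kind := Sum.elim G.kind fun _ => .sink
  succ
    | .inl x =>
      match G.kind x with
      | .sink => {Sum.inl x}
      | _ => redirect A x '' G.succ x
    | .inr e => {Sum.inr e}
  succ_nonempty := by
    rintro (x | e)
    · have := (G.succ_nonempty x).image (redirect A x)
      cases h : G.kind x <;> simp_all
    · simp
  succ_sink := by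
    rintro (x | e) h
    · simp only [Sum.elim_inl] at h
      simp [h]
    · rfl
  exists_sink := G.exists_sink.elim fun s hs => ⟨Sum.inl s, hs⟩
  prob
    | .inl x => (G.prob x).map (redirect A x)
    | .inr e => PMF.pure (Sum.inr e)
  support_prob := by
    rintro (x | e) h
    · simp only [Sum.elim_inl] at h
      simp [h, PMF.support_map, G.support_prob x h]
    · simp at h
  val := Sum.elim G.val fun e => (f e : ℝ)
  val_mem := by
    rintro (x | e) h
    · exact G.val_mem x h
    · exact (f e).2

theorem redirect_mem_fix_succ (G : SSG V) (A : Set (V × V)) (f : A → Set.Icc (0 : ℝ) 1)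
    {x y : V} (hx : G.kind x ≠ .sink) (hy : y ∈ G.succ x) :
    redirect A x y ∈ (G.fix A f).succ (Sum.inl x) := by
  have := Set.mem_image_of_mem (redirect A x) hy
  cases h : G.kind x <;> simp_all [fix]

/-- A MAX strategy of `G`, read as a strategy of `G[A, f]`. -/
noncomputable def liftMax (G : SSG V) (A : Set (V × V)) (f : A → Set.Icc (0 : ℝ) 1)
    (σ : G.MaxStrategy) : (G.fix A f).MaxStrategy
  | ⟨.inl x, h⟩ =>
    have hx : G.kind x = .maxV := h
    ⟨redirect A x (σ ⟨x, hx⟩).1, G.redirect_mem_fix_succ A f (by simp [hx]) (σ ⟨x, hx⟩).2⟩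
  | ⟨.inr _, h⟩ => VertexKind.noConfusion h

/-- A MIN strategy of `G`, read as a strategy of `G[A, f]`. -/
noncomputable def liftMin (G : SSG V) (A : Set (V × V)) (f : A → Set.Icc (0 : ℝ) 1)
    (τ : G.MinStrategy) : (G.fix A f).MinStrategy
  | ⟨.inl x, h⟩ =>
    have hx : G.kind x = .minV := h
    ⟨redirect A x (τ ⟨x, hx⟩).1, G.redirect_mem_fix_succ A f (by simp [hx]) (τ ⟨x, hx⟩).2⟩
  | ⟨.inr _, h⟩ => VertexKind.noConfusion h

/-- The values of the new sinks of `G[A, σ]`: an arc `(x, y)` of `A` gets `v_σ(y)`. -/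
noncomputable def arcValue (G : SSG V) (A : Set (V × V)) (σ : G.MaxStrategy) (e : A) :
    Set.Icc (0 : ℝ) 1 :=
  ⟨G.strategyValue σ e.1.2, G.strategyValue_mem σ e.1.2⟩

/-- `σ'` strongly improves on `σ` in the game `G[A, σ]`. -/
def ImprovesIn (G : SSG V) (A : Set (V × V)) (σ' σ : G.MaxStrategy) : Prop :=
  (G.fix A (G.arcValue A σ)).StronglyImproves
    (G.liftMax A (G.arcValue A σ) σ') (G.liftMax A (G.arcValue A σ) σ)

/-! ### The generic strategy improvement algorithm and its cost -/

/-- The arcs that enter a random vertex. -/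
def arcsToRandom (G : SSG V) : Set (V × V) := {e | e ∈ G.arcs ∧ G.kind e.2 = .random}

/-- `τ` is a response of MIN to `σ'` that is computed from `σ'` and from the order of the values
`v` on the random vertices and the sinks: it is a best response to `σ'` when a play that enters a
random vertex `y` stops there with value `w y`. Nothing is used of `v` but the order, as `w` may
be any function with the same order. -/
def IsOrderResponse (G : SSG V) (v : V → ℝ) (σ' : G.MaxStrategy) (τ : G.MinStrategy) : Prop :=
  ∃ w : V → Set.Icc (0 : ℝ) 1,
    (∀ s, G.kind s = .sink → (w s : ℝ) = G.val s) ∧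
    (∀ x y, (G.kind x = .random ∨ G.kind x = .sink) → (G.kind y = .random ∨ G.kind y = .sink) →
      (w x < w y ↔ v x < v y)) ∧
    (G.fix G.arcsToRandom fun e => w e.1.2).IsBestResponse
      (G.liftMax G.arcsToRandom (fun e => w e.1.2) σ')
      (G.liftMin G.arcsToRandom (fun e => w e.1.2) τ)

/-- An execution of the first `N` rounds of the generic strategy improvement algorithm, for an
arbitrary initial strategy, arbitrary sets of arcs and an arbitrary way to find the improving
strategies. Only the indices up to `N` are meaningful. -/
structure Execution (G : SSG V) (N : ℕ) where
  /-- the current MAX strategy -/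
  σ : ℕ → G.MaxStrategy
  /-- the best response to the current MAX strategy -/
  τ : ℕ → G.MinStrategy
  /-- the chosen set of arcs -/
  A : ℕ → Set (V × V)
  /-- the candidate for a best response to `σ (i + 1)`, read off from the order of the values of
  `σ i` at the random vertices and the sinks -/
  candidate : ℕ → G.MinStrategy
  bestResponse : ∀ i ≤ N, G.IsBestResponse (σ i) (τ i)
  notOptimal : ∀ i < N, ¬ G.IsOptimalPair (σ i) (τ i)
  arcs_subset : ∀ i < N, A i ⊆ G.arcs
  improves : ∀ i < N, G.ImprovesIn (A i) (σ (i + 1)) (σ i)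
  orderResponse : ∀ i < N,
    G.IsOrderResponse (G.strategyValue (σ i)) (σ (i + 1)) (candidate i)

/-- The prices of the subroutines. -/
structure Costs where
  /-- `C₁ m p` is the cost of computing the values of a strategy, for size `m` and precision
  `p`. -/
  C₁ : ℕ → ℕ → ℝ
  /-- `C₂ n r q` is the cost of finding an improving strategy in the transformed game (with the
  choice of the arcs and the construction of that game). -/
  C₂ : ℕ → ℕ → ℕ → ℝ
  /-- The implied constant of the elementary subroutines. -/
  c₀ : ℝ

/-- The cost `c₀ (r log r + n)` of ordering the random vertices by value, computing a
response of MIN from the order, and testing the optimality conditions. -/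
noncomputable def Costs.order (C : Costs) (n r : ℕ) : ℝ :=
  C.c₀ * ((r : ℝ) * Real.log r + (n : ℝ))

/-- The cost of computing `v_{σ,τ}` for a pair of strategies: a linear system of dimension `r`
has to be solved. -/
noncomputable def Costs.pair (C : Costs) (r q : ℕ) : ℝ := C.c₀ * C.C₁ r (q ^ r)

open Classical in
/-- The cost of computing the value vector of the strategy `σ (i + 1)` of an execution. If there
are at least as many random vertices as MAX vertices, it is computed from scratch, at cost
`C₁ n (q ^ r)`. Otherwise the candidate is computed and its values are evaluated; they are the
values of `σ (i + 1)` if the candidate is a best response, and if the test shows that it is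
not, the values of `σ (i + 1)` are computed from scratch. -/
noncomputable def Execution.updateCost {G : SSG V} {N : ℕ} (E : G.Execution N) (C : Costs)
    (q i : ℕ) : ℝ :=
  if G.numRandom < G.numMax then
    C.order G.numMax G.numRandom + C.pair G.numRandom q +
      if G.IsBestResponse (E.σ (i + 1)) (E.candidate i) then 0
      else C.C₁ G.numMax (q ^ G.numRandom)
  else C.C₁ G.numMax (q ^ G.numRandom)

/-- The total cost of an execution: the values of the initial strategy are computed from
scratch, and then each round finds an improving strategy and computes its values. -/
noncomputable def Execution.totalCost {G : SSG V} {N : ℕ} (E : G.Execution N) (C : Costs)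
    (q : ℕ) : ℝ :=
  C.C₁ G.numMax (q ^ G.numRandom) +
    ∑ i ∈ Finset.range N, (C.C₂ G.numMax G.numRandom q + E.updateCost C q i)

/-- `C₁` grows at least quadratically in the size, with implied constant `κ`. -/
def Costs.AtLeastQuadratic (C : Costs) (κ : ℝ) : Prop :=
  (∀ m p : ℕ, 1 ≤ m → 1 ≤ p → (m : ℝ) ^ 2 ≤ κ * C.C₁ m p) ∧
  ∀ a b p : ℕ, 1 ≤ a → a ≤ b → 1 ≤ p →
    C.C₁ a p / (a : ℝ) ^ 2 ≤ κ * (C.C₁ b p / (b : ℝ) ^ 2)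

/-- `C₂(n, r, q) = O(C₁(n, q ^ r) r / n)`, with implied constant `c`. -/
def Costs.CheapImprovement (C : Costs) (c : ℝ) : Prop :=
  ∀ n r q : ℕ, 1 ≤ n → 1 ≤ r → 1 ≤ q →
    C.C₂ n r q ≤ c * (C.C₁ n (q ^ r) * (r : ℝ) / (n : ℝ))

end SSG

/-! ### Expectations under laws on a finite set -/

namespace SSG
open MeasureTheory ProbabilityTheory

variable {V : Type u}

/-! Everything rests on a gap and a monotonicity. Put δ = q^(-r).

Gap: the values of a fixed pair of strategies solve a linear system with integer coefficients whose
determinant is positive and at most q^r. By Cramer's rule they share a denominator at most q^r, so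
two distinct values of the same strategy differ by at least δ (`IsQSSG.inv_pow_le_sub`).

Monotonicity: an improvement in the transformed game is an improvement in `G`, that is, v ≤ v' for
the old and new value vectors (`ImprovesIn.strategyValue_le`). The game may be non-stopping, so the
clause that the strategy is kept where the value is unchanged is essential.

If v(x) < v(y) and v'(x) ≥ v'(y), then v'(x) ≥ v'(y) ≥ v(y) ≥ v(x) + δ. This is the second claim.
Applied to a MAX vertex x that switches to a better successor y, where v'(x) = v'(y), it shows that
some MAX vertex gains δ in every round. Values lie in [0,1] and never decrease, so there are at most
n q^r rounds.

The candidate response depends only on the order of the values at random vertices and sinks. If the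
order is the same for v and v', the candidate is a best response (`IsOrderResponse.isBestResponse`).
So a failure means either that a strict comparison is lost, and then a random vertex gains δ, which
happens at most r q^r times, or that ties are only broken, and then the number of distinct values,
at most r + 2, grows. A potential argument with this number bounds the failures by 5 r q^r
(`Execution.sum_failed_le`).

When r < n, an ordinary round costs O(C₁ r / n), and n q^r of these cost O(r q^r C₁), as do the
failures. When r ≥ n, computing every value vector from scratch is affordable because n q^r ≤ r q^r.
-/

/-- The expectation of a function under a law on a finite set. -/
noncomputable def expect (p : PMF V) (f : V → ℝ) : ℝ := ∑' y, (p y).toReal * f y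

theorem expect_eq_sum [Fintype V] (p : PMF V) (f : V → ℝ) :
    expect p f = ∑ y, (p y).toReal * f y := tsum_fintype _

theorem sum_toReal_eq_one [Fintype V] (p : PMF V) : ∑ y, (p y).toReal = 1 := by
  rw [← ENNReal.toReal_sum fun y _ => p.apply_ne_top y, ← tsum_fintype (L := .unconditional _),
    p.tsum_coe, ENNReal.toReal_one]

section Expect

variable [Finite V]

theorem expect_eq_integral (p : PMF V) (f : V → ℝ) :
    letI : MeasurableSpace V := ⊤
    ∫ y, f y ∂p.toMeasure = expect p f := by
  have := Fintype.ofFinite V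
  let : MeasurableSpace V := ⊤
  have : DiscreteMeasurableSpace V := ⟨fun _ => trivial⟩
  rw [PMF.integral_eq_sum, expect_eq_sum]
  rfl

theorem expect_pure (x : V) (f : V → ℝ) : expect (PMF.pure x) f = f x := by
  classical
  have := Fintype.ofFinite V
  rw [expect_eq_sum, Finset.sum_eq_single x] <;> simp +contextual [PMF.pure_apply]

theorem expect_const (p : PMF V) (c : ℝ) : expect p (fun _ => c) = c := by
  have := Fintype.ofFinite V
  rw [expect_eq_sum, ← Finset.sum_mul, sum_toReal_eq_one, one_mul]

theorem expect_mono (p : PMF V) {f g : V → ℝ} (h : ∀ y ∈ p.support, f y ≤ g y) :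
    expect p f ≤ expect p g := by
  have := Fintype.ofFinite V
  rw [expect_eq_sum, expect_eq_sum]
  refine Finset.sum_le_sum fun y _ => ?_
  by_cases hy : y ∈ p.support
  · exact mul_le_mul_of_nonneg_left (h y hy) ENNReal.toReal_nonneg
  · simp [(p.apply_eq_zero_iff y).2 hy]

theorem expect_le (p : PMF V) {f : V → ℝ} {c : ℝ} (h : ∀ y ∈ p.support, f y ≤ c) :
    expect p f ≤ c := (expect_mono p h).trans_eq (expect_const p c)

theorem expect_nonneg (p : PMF V) {f : V → ℝ} (h : ∀ y, 0 ≤ f y) : 0 ≤ expect p f :=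
  (expect_const p 0).ge.trans (expect_mono p fun y _ => h y)

theorem expect_sub (p : PMF V) (f g : V → ℝ) :
    expect p (fun y => f y - g y) = expect p f - expect p g := by
  have := Fintype.ofFinite V
  simp only [expect_eq_sum, mul_sub, Finset.sum_sub_distrib]

/-- A function bounded by `c` whose mean is at least `c` is `c` on the support. -/
theorem eq_of_le_expect (p : PMF V) {f : V → ℝ} {c : ℝ} (h : ∀ y ∈ p.support, f y ≤ c)
    (hc : c ≤ expect p f) : ∀ y ∈ p.support, f y = c := by
  classical
  have := Fintype.ofFinite V
  intro y hy
  by_contra hne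
  have hlt : expect p f < expect p fun _ => c := by
    rw [expect_eq_sum, expect_eq_sum]
    refine Finset.sum_lt_sum (fun z _ => ?_) ⟨y, Finset.mem_univ y, ?_⟩
    · by_cases hz : z ∈ p.support
      · exact mul_le_mul_of_nonneg_left (h z hz) ENNReal.toReal_nonneg
      · simp [(p.apply_eq_zero_iff z).2 hz]
    · exact mul_lt_mul_of_pos_left ((h y hy).lt_of_ne hne)
        (ENNReal.toReal_pos ((p.mem_support_iff y).1 hy) (p.apply_ne_top y))
  rw [expect_const] at hlt
  exact hlt.not_ge hc

theorem expect_map {W : Type*} [Finite W] (p : PMF V) (g : V → W) (f : W → ℝ) :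
    expect (p.map g) f = expect p (f ∘ g) := by
  classical
  have := Fintype.ofFinite V
  have := Fintype.ofFinite W
  rw [expect_eq_sum, expect_eq_sum, ← Finset.sum_fiberwise (g := g)]
  refine Finset.sum_congr rfl fun w _ => ?_
  rw [PMF.map_apply, tsum_fintype, ENNReal.toReal_sum, Finset.sum_mul, Finset.sum_filter]
  · refine Finset.sum_congr rfl fun y _ => ?_
    by_cases hy : w = g y
    · simp [hy]
    · simp [hy, Ne.symm hy]
  · intro y _
    split_ifs
    · exact p.apply_ne_top y
    · exact ENNReal.zero_ne_top

end Expect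

/-! ### The value as a least fixed point -/

theorem step_maxV (G : SSG V) (σ : G.MaxStrategy) (τ : G.MinStrategy) {x : V}
    (h : G.kind x = .maxV) : G.step σ τ x = PMF.pure (σ ⟨x, h⟩).1 := by
  unfold step
  split <;> first | rfl | (rename_i h'; exact absurd (h.symm.trans h') (by simp))

theorem step_minV (G : SSG V) (σ : G.MaxStrategy) (τ : G.MinStrategy) {x : V}
    (h : G.kind x = .minV) : G.step σ τ x = PMF.pure (τ ⟨x, h⟩).1 := by
  unfold step
  split <;> first | rfl | (rename_i h'; exact absurd (h.symm.trans h') (by simp))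

theorem step_random (G : SSG V) (σ : G.MaxStrategy) (τ : G.MinStrategy) {x : V}
    (h : G.kind x = .random) : G.step σ τ x = G.prob x := by
  unfold step
  split <;> first | rfl | (rename_i h'; exact absurd (h.symm.trans h') (by simp))

theorem step_sink (G : SSG V) (σ : G.MaxStrategy) (τ : G.MinStrategy) {x : V}
    (h : G.kind x = .sink) : G.step σ τ x = PMF.pure x := by
  unfold step
  split <;> first | rfl | (rename_i h'; exact absurd (h.symm.trans h') (by simp))

open Classical in
/-- The payoff of a play that stops at `x`. -/
noncomputable def payoff (G : SSG V) (x : V) : ℝ := if G.kind x = .sink then G.val x else 0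

theorem payoff_sink (G : SSG V) {x : V} (h : G.kind x = .sink) : G.payoff x = G.val x := by
  simp [payoff, h]

theorem payoff_of_ne (G : SSG V) {x : V} (h : G.kind x ≠ .sink) : G.payoff x = 0 := by
  simp [payoff, h]

theorem payoff_mem (G : SSG V) (x : V) : G.payoff x ∈ Set.Icc (0 : ℝ) 1 := by
  unfold payoff
  split_ifs with h
  · exact G.val_mem x h
  · simp

/-- The transition operator of the Markov chain of a pair of strategies. -/
noncomputable def transition (G : SSG V) (σ : G.MaxStrategy) (τ : G.MinStrategy) (f : V → ℝ)
    (x : V) : ℝ := expect (G.step σ τ x) f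

theorem integral_playMeasure_zero (G : SSG V) (σ : G.MaxStrategy) (τ : G.MinStrategy) (x : V)
    (f : V → ℝ) :
    letI : MeasurableSpace V := ⊤
    ∫ X, f (X 0) ∂(G.playMeasure σ τ x) = f x := by
  let : MeasurableSpace V := ⊤
  have hd : DiscreteMeasurableSpace V := ⟨fun _ => trivial⟩
  let last : ((i : Finset.Iic 0) → (fun _ : ℕ => V) i) → V := fun h => h ⟨0, Finset.mem_Iic.2 le_rfl⟩
  have hlast : Measurable last := measurable_pi_apply _
  have hf : Measurable f := Measurable.of_discrete
  have h1 : ∫ X, f (X 0) ∂(G.playMeasure σ τ x) =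
      ∫ h, f (last h) ∂((Kernel.traj (X := fun _ : ℕ => V)
          (G.stepKernel σ τ) 0 (fun _ => x)).map (Preorder.frestrictLe 0)) := by
    have hm : Measurable fun h : (i : Finset.Iic 0) → (fun _ : ℕ => V) i => f (last h) :=
      hf.comp hlast
    rw [integral_map (by fun_prop) hm.aestronglyMeasurable]
    rfl
  rw [h1, Kernel.traj_map_frestrictLe_apply, Kernel.partialTraj_self, Kernel.id_apply]
  exact integral_dirac' (fun h => f (last h)) _ (hf.comp hlast).stronglyMeasurable

variable [Finite V]

instance (G : SSG V) (σ : G.MaxStrategy) (τ : G.MinStrategy) (x : V) :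
    letI : MeasurableSpace V := ⊤
    IsProbabilityMeasure (G.playMeasure σ τ x) := by
  let : MeasurableSpace V := ⊤
  unfold playMeasure
  infer_instance

/-- The joint law of the history up to time `n` and the next vertex is a composition product with
the step kernel, so the next vertex can be integrated out. `F` has two arguments so that it can also
detect leaving a sink. -/
theorem integral_pair_playMeasure (G : SSG V) (σ : G.MaxStrategy) (τ : G.MinStrategy) (x : V)
    (n : ℕ) (F : V → V → ℝ) :
    letI : MeasurableSpace V := ⊤
    ∫ X, F (X n) (X (n + 1)) ∂(G.playMeasure σ τ x) =
      ∫ X, expect (G.step σ τ (X n)) (F (X n)) ∂(G.playMeasure σ τ x) := by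
  let : MeasurableSpace V := ⊤
  have hd : DiscreteMeasurableSpace V := ⟨fun _ => trivial⟩
  obtain ⟨C, hC⟩ : ∃ C : ℝ, ∀ a b, ‖F a b‖ ≤ C := by
    obtain ⟨C, hC⟩ := (Set.finite_range fun p : V × V => ‖F p.1 p.2‖).bddAbove
    exact ⟨C, fun a b => hC ⟨(a, b), rfl⟩⟩
  let last : ((i : Finset.Iic n) → (fun _ : ℕ => V) i) → V := fun h => h ⟨n, Finset.mem_Iic.2 le_rfl⟩
  have hlast : Measurable last := measurable_pi_apply _
  have key := Kernel.partialTraj_compProd_eq_map_traj (X := fun _ : ℕ => V)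
    (κ := G.stepKernel σ τ) (Nat.zero_le n) (x₀ := fun _ => x)
  have hF : Measurable fun p : ((i : Finset.Iic n) → (fun _ : ℕ => V) i) × V =>
      F (last p.1) p.2 := by
    have : Measurable fun p : V × V => F p.1 p.2 := Measurable.of_discrete
    exact this.comp ((hlast.comp measurable_fst).prodMk measurable_snd)
  have h1 : ∫ X, F (X n) (X (n + 1)) ∂(G.playMeasure σ τ x) =
      ∫ p, F (last p.1) p.2 ∂((Kernel.traj (X := fun _ : ℕ => V) (G.stepKernel σ τ) 0
        (fun _ => x)).map (fun X => (Preorder.frestrictLe n X, X (n + 1)))) := by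
    rw [integral_map (by fun_prop) hF.aestronglyMeasurable]
    rfl
  rw [h1, ← key, Measure.integral_compProd]
  · have h2 : ∫ X, expect (G.step σ τ (X n)) (F (X n)) ∂(G.playMeasure σ τ x) =
        ∫ h, expect (G.step σ τ (last h)) (F (last h)) ∂((Kernel.traj (X := fun _ : ℕ => V)
          (G.stepKernel σ τ) 0 (fun _ => x)).map (Preorder.frestrictLe n)) := by
      rw [integral_map (by fun_prop)]
      · rfl
      · have : Measurable fun a : V => expect (G.step σ τ a) (F a) := Measurable.of_discrete
        exact (this.comp hlast).aestronglyMeasurable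
    rw [h2, Kernel.traj_map_frestrictLe_apply]
    refine integral_congr_ae (Filter.Eventually.of_forall fun h => ?_)
    exact expect_eq_integral (G.step σ τ (last h)) (F (last h))
  · exact Integrable.of_bound hF.aestronglyMeasurable C (Filter.Eventually.of_forall fun p => hC _ _)

theorem integral_playMeasure (G : SSG V) (σ : G.MaxStrategy) (τ : G.MinStrategy) (x : V)
    (n : ℕ) (f : V → ℝ) :
    letI : MeasurableSpace V := ⊤
    ∫ X, f (X n) ∂(G.playMeasure σ τ x) = ((G.transition σ τ)^[n] f) x := by
  let : MeasurableSpace V := ⊤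
  induction n generalizing f with
  | zero => exact G.integral_playMeasure_zero σ τ x f
  | succ n ih =>
    rw [G.integral_pair_playMeasure σ τ x n fun _ b => f b, Function.iterate_succ_apply, ← ih]
    rfl

theorem ae_absorbing (G : SSG V) (σ : G.MaxStrategy) (τ : G.MinStrategy) (x : V) :
    letI : MeasurableSpace V := ⊤
    ∀ᵐ X ∂(G.playMeasure σ τ x), ∀ n, G.kind (X n) = .sink → X (n + 1) = X n := by
  classical
  let : MeasurableSpace V := ⊤
  have hd : DiscreteMeasurableSpace V := ⟨fun _ => trivial⟩
  rw [ae_all_iff]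
  intro n
  let F : V → V → ℝ := fun a b => if G.kind a = .sink ∧ b ≠ a then 1 else 0
  have hF0 : ∀ a b, 0 ≤ F a b := fun a b => by positivity
  have hFm : Measurable fun X : ℕ → V => F (X n) (X (n + 1)) := by
    have : Measurable fun p : V × V => F p.1 p.2 := Measurable.of_discrete
    have hp : Measurable fun X : ℕ → V => (X n, X (n + 1)) := by fun_prop
    exact this.comp hp
  have hint : ∫ X, F (X n) (X (n + 1)) ∂(G.playMeasure σ τ x) = 0 := by
    rw [G.integral_pair_playMeasure σ τ x n F]
    refine integral_eq_zero_of_ae (Filter.Eventually.of_forall fun X => ?_)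
    beta_reduce
    by_cases h : G.kind (X n) = .sink
    · rw [step_sink G σ τ h, expect_pure]
      simp [F]
    · simp only [F, h, false_and, if_false, Pi.zero_apply]
      exact expect_const _ _
  rw [integral_eq_zero_iff_of_nonneg (fun X => hF0 _ _)
    (Integrable.of_bound hFm.aestronglyMeasurable 1
      (Filter.Eventually.of_forall fun X => by simp only [F]; split_ifs <;> simp))] at hint
  filter_upwards [hint] with X hX hs
  by_contra hne
  simp [F, hs, hne] at hX

open Filter Topology in
-- Almost every play stays at the first sink it meets, so the payoff at time `n` is eventually the
-- value of the play; dominated convergence concludes.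
theorem tendsto_value (G : SSG V) (σ : G.MaxStrategy) (τ : G.MinStrategy) (x : V) :
    Tendsto (fun n => ((G.transition σ τ)^[n] G.payoff) x) atTop (𝓝 (G.value σ τ x)) := by
  classical
  let : MeasurableSpace V := ⊤
  have hd : DiscreteMeasurableSpace V := ⟨fun _ => trivial⟩
  simp_rw [← G.integral_playMeasure σ τ x]
  refine tendsto_integral_of_dominated_convergence (fun _ => (1 : ℝ)) (fun n => ?_)
    (integrable_const _) (fun n => Eventually.of_forall fun X => ?_) ?_
  · have : Measurable G.payoff := Measurable.of_discrete
    exact (this.comp (measurable_pi_apply n)).aestronglyMeasurable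
  · rw [Real.norm_of_nonneg (G.payoff_mem _).1]
    exact (G.payoff_mem _).2
  · filter_upwards [G.ae_absorbing σ τ x] with X hX
    unfold playValue
    split_ifs with h
    · refine tendsto_const_nhds.congr' ?_
      filter_upwards [eventually_ge_atTop (Nat.find h)] with n hn
      have : X n = X (Nat.find h) := by
        induction n, hn using Nat.le_induction with
        | base => rfl
        | succ n _ ih => rw [hX n (ih ▸ Nat.find_spec h), ih]
      rw [this, G.payoff_sink (Nat.find_spec h)]
    · push Not at h
      simp only [G.payoff_of_ne (h _)]
      exact tendsto_const_nhds

theorem transition_mono (G : SSG V) (σ : G.MaxStrategy) (τ : G.MinStrategy) {f g : V → ℝ}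
    (h : f ≤ g) : G.transition σ τ f ≤ G.transition σ τ g :=
  fun _ => expect_mono _ fun y _ => h y

/-- The iterates of the payoff stay below `f` by monotonicity. This minimality singles out the value
among the solutions of the fixed point equation, which need not be unique in a non-stopping game. -/
theorem value_le_of_transition_le (G : SSG V) (σ : G.MaxStrategy) (τ : G.MinStrategy)
    {f : V → ℝ} (h₀ : G.payoff ≤ f) (h : G.transition σ τ f ≤ f) : G.value σ τ ≤ f := by
  intro x
  refine le_of_tendsto' (G.tendsto_value σ τ x) fun n => ?_
  suffices ∀ n, (G.transition σ τ)^[n] G.payoff ≤ f from this n x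
  intro n
  induction n with
  | zero => exact h₀
  | succ n ih =>
    rw [Function.iterate_succ_apply']
    exact (G.transition_mono σ τ ih).trans h

open Filter Topology in
theorem transition_value (G : SSG V) (σ : G.MaxStrategy) (τ : G.MinStrategy) :
    G.transition σ τ (G.value σ τ) = G.value σ τ := by
  have := Fintype.ofFinite V
  funext x
  refine tendsto_nhds_unique ?_ ((G.tendsto_value σ τ x).comp (tendsto_add_atTop_nat 1))
  simp only [Function.comp_def, Function.iterate_succ_apply']
  simp only [transition, expect_eq_sum]
  exact tendsto_finsetSum _ fun y _ => (G.tendsto_value σ τ y).const_mul _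

theorem value_sink (G : SSG V) (σ : G.MaxStrategy) (τ : G.MinStrategy) {x : V}
    (h : G.kind x = .sink) : G.value σ τ x = G.val x := by
  refine tendsto_nhds_unique (G.tendsto_value σ τ x) ?_
  suffices ∀ n, ((G.transition σ τ)^[n] G.payoff) x = G.val x by
    simp only [this]
    exact tendsto_const_nhds
  intro n
  induction n with
  | zero => exact G.payoff_sink h
  | succ n ih => rw [Function.iterate_succ_apply', transition, step_sink G σ τ h, expect_pure, ih]

end SSG

namespace SSG

variable {V : Type u}

/-! ### The transformed game -/

/-- Lets agreement of two lifted strategies at a vertex descend to the original strategies. -/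
theorem redirect_injective (A : Set (V × V)) (x : V) : Function.Injective (redirect A x) := by
  intro y z h
  unfold redirect at h
  split_ifs at h <;> simp_all

theorem exists_of_mem_fix_succ (G : SSG V) (A : Set (V × V)) (f : A → Set.Icc (0 : ℝ) 1) {x : V}
    (hx : G.kind x ≠ .sink) {z : V ⊕ A} (hz : z ∈ (G.fix A f).succ (Sum.inl x)) :
    ∃ y ∈ G.succ x, redirect A x y = z := by
  unfold fix at hz
  cases h : G.kind x <;> simp_all

/-- A function on `V`, extended to the new sinks of `G[A, f]` by their values. -/
noncomputable def extend (A : Set (V × V)) (f : A → Set.Icc (0 : ℝ) 1) (g : V → ℝ) :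
    V ⊕ A → ℝ := Sum.elim g fun e => (f e : ℝ)

section Fix

variable (G : SSG V) (A : Set (V × V)) (f : A → Set.Icc (0 : ℝ) 1)

theorem payoff_fix_inr (e : A) : (G.fix A f).payoff (Sum.inr e) = f e :=
  (G.fix A f).payoff_sink (x := Sum.inr e) rfl

/-- The new sinks carry the values of the vertices that they replace, so harmonicity of `v_σ` is
insensitive to the redirection. -/
theorem extend_arcValue_redirect (σ : G.MaxStrategy) (x y : V) :
    extend A (G.arcValue A σ) (G.strategyValue σ) (redirect A x y) = G.strategyValue σ y := by
  unfold redirect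
  split_ifs with h <;> rfl

end Fix

/-! ### Best responses -/

theorem strategyValue_le_value (G : SSG V) (σ : G.MaxStrategy) (τ : G.MinStrategy) :
    G.strategyValue σ ≤ G.value σ τ := by
  intro x
  refine ciInf_le ⟨0, ?_⟩ τ
  rintro _ ⟨τ', rfl⟩
  exact (G.value_mem σ τ' x).1

theorem IsBestResponse.value_eq {G : SSG V} {σ : G.MaxStrategy} {τ : G.MinStrategy}
    (h : G.IsBestResponse σ τ) : G.value σ τ = G.strategyValue σ :=
  funext fun x => le_antisymm (le_ciInf fun τ' => h τ' x) (G.strategyValue_le_value σ τ x)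

theorem isBestResponse_of_value_le {G : SSG V} {σ : G.MaxStrategy} {τ : G.MinStrategy}
    (h : G.value σ τ ≤ G.strategyValue σ) : G.IsBestResponse σ τ :=
  fun τ' x => (h x).trans (G.strategyValue_le_value σ τ' x)

variable [Finite V]

theorem value_maxV (G : SSG V) (σ : G.MaxStrategy) (τ : G.MinStrategy) {x : V}
    (h : G.kind x = .maxV) : G.value σ τ x = G.value σ τ (σ ⟨x, h⟩).1 := by
  conv_lhs => rw [← G.transition_value σ τ, transition, step_maxV G σ τ h, expect_pure]

theorem value_minV (G : SSG V) (σ : G.MaxStrategy) (τ : G.MinStrategy) {x : V}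
    (h : G.kind x = .minV) : G.value σ τ x = G.value σ τ (τ ⟨x, h⟩).1 := by
  conv_lhs => rw [← G.transition_value σ τ, transition, step_minV G σ τ h, expect_pure]

theorem value_random (G : SSG V) (σ : G.MaxStrategy) (τ : G.MinStrategy) {x : V}
    (h : G.kind x = .random) : G.value σ τ x = expect (G.prob x) (G.value σ τ) := by
  conv_lhs => rw [← G.transition_value σ τ, transition, step_random G σ τ h]

theorem payoff_le_value (G : SSG V) (σ : G.MaxStrategy) (τ : G.MinStrategy) (x : V) :
    G.payoff x ≤ G.value σ τ x := by
  by_cases h : G.kind x = .sink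
  · rw [G.payoff_sink h, G.value_sink σ τ h]
  · rw [G.payoff_of_ne h]
    exact (G.value_mem σ τ x).1

/-- `f` bounds the payoffs, and MIN can keep the expectation of `f` from growing against `σ`. -/
structure IsSupersolution (G : SSG V) (σ : G.MaxStrategy) (f : V → ℝ) : Prop where
  payoff_le : G.payoff ≤ f
  maxV : ∀ x (h : G.kind x = .maxV), f (σ ⟨x, h⟩).1 ≤ f x
  minV : ∀ x, G.kind x = .minV → ∃ y ∈ G.succ x, f y ≤ f x
  random : ∀ x, G.kind x = .random → expect (G.prob x) f ≤ f x

theorem transition_le (G : SSG V) (σ : G.MaxStrategy) (τ : G.MinStrategy) {f : V → ℝ}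
    (hmax : ∀ x (h : G.kind x = .maxV), f (σ ⟨x, h⟩).1 ≤ f x)
    (hmin : ∀ x (h : G.kind x = .minV), f (τ ⟨x, h⟩).1 ≤ f x)
    (hr : ∀ x, G.kind x = .random → expect (G.prob x) f ≤ f x) :
    G.transition σ τ f ≤ f := by
  intro x
  unfold transition
  cases h : G.kind x
  · rw [step_maxV G σ τ h, expect_pure]
    exact hmax x h
  · rw [step_minV G σ τ h, expect_pure]
    exact hmin x h
  · rw [step_random G σ τ h]
    exact hr x h
  · rw [step_sink G σ τ h, expect_pure]

/-- MIN plays, at each vertex, a successor that does not increase `f`. -/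
theorem IsSupersolution.exists_value_le {G : SSG V} {σ : G.MaxStrategy} {f : V → ℝ}
    (hf : G.IsSupersolution σ f) : ∃ τ, G.value σ τ ≤ f := by
  choose g hg hgf using hf.minV
  exact ⟨fun x => ⟨g x.1 x.2, hg x.1 x.2⟩, G.value_le_of_transition_le σ _ hf.payoff_le
    (G.transition_le σ _ hf.maxV (fun x h => hgf x h) hf.random)⟩

/-- The pointwise minimum of two value vectors is a supersolution, hence bounds the values of some
response. The value vectors are thus directed downwards, and a finite directed family has a least
element. -/
theorem exists_isBestResponse (G : SSG V) (σ : G.MaxStrategy) : ∃ τ, G.IsBestResponse σ τ := by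
  have hd : Directed (· ≥ ·) (G.value σ) := by
    intro τ₁ τ₂
    suffices h : G.IsSupersolution σ fun x => min (G.value σ τ₁ x) (G.value σ τ₂ x) by
      obtain ⟨τ, hτ⟩ := h.exists_value_le
      have h₁ : G.value σ τ ≤ G.value σ τ₁ := fun x => (hτ x).trans (min_le_left _ _)
      have h₂ : G.value σ τ ≤ G.value σ τ₂ := fun x => (hτ x).trans (min_le_right _ _)
      exact ⟨τ, h₁, h₂⟩
    refine ⟨fun x => le_min (G.payoff_le_value _ _ x) (G.payoff_le_value _ _ x), ?_, ?_, ?_⟩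
    · intro x h
      simp only [G.value_maxV σ _ h, le_refl]
    · intro x h
      rcases min_choice (G.value σ τ₁ x) (G.value σ τ₂ x) with h' | h'
      · refine ⟨_, (τ₁ ⟨x, h⟩).2, ?_⟩
        rw [h', G.value_minV σ τ₁ h]
        exact min_le_left _ _
      · refine ⟨_, (τ₂ ⟨x, h⟩).2, ?_⟩
        rw [h', G.value_minV σ τ₂ h]
        exact min_le_right _ _
    · intro x h
      rw [G.value_random σ _ h, G.value_random σ _ h]
      exact le_min (expect_mono _ fun y _ => min_le_left _ _)
        (expect_mono _ fun y _ => min_le_right _ _)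
  have hfin : Finite G.MinStrategy := Pi.finite
  obtain ⟨τ, hτ⟩ := hd.finite_le id
  exact ⟨τ, fun τ' x => hτ τ' x⟩

theorem IsSupersolution.strategyValue_le {G : SSG V} {σ : G.MaxStrategy} {f : V → ℝ}
    (hf : G.IsSupersolution σ f) : G.strategyValue σ ≤ f :=
  let ⟨τ, hτ⟩ := hf.exists_value_le
  (G.strategyValue_le_value σ τ).trans hτ

theorem payoff_le_strategyValue (G : SSG V) (σ : G.MaxStrategy) (x : V) :
    G.payoff x ≤ G.strategyValue σ x := by
  obtain ⟨τ, hτ⟩ := G.exists_isBestResponse σ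
  rw [← hτ.value_eq]
  exact G.payoff_le_value σ τ x

theorem strategyValue_sink (G : SSG V) (σ : G.MaxStrategy) {x : V} (h : G.kind x = .sink) :
    G.strategyValue σ x = G.val x := by
  obtain ⟨τ, hτ⟩ := G.exists_isBestResponse σ
  rw [← hτ.value_eq, G.value_sink σ τ h]

theorem strategyValue_maxV (G : SSG V) (σ : G.MaxStrategy) {x : V} (h : G.kind x = .maxV) :
    G.strategyValue σ x = G.strategyValue σ (σ ⟨x, h⟩).1 := by
  obtain ⟨τ, hτ⟩ := G.exists_isBestResponse σ
  rw [← hτ.value_eq]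
  exact G.value_maxV σ τ h

theorem strategyValue_random (G : SSG V) (σ : G.MaxStrategy) {x : V} (h : G.kind x = .random) :
    G.strategyValue σ x = expect (G.prob x) (G.strategyValue σ) := by
  obtain ⟨τ, hτ⟩ := G.exists_isBestResponse σ
  rw [← hτ.value_eq]
  exact G.value_random σ τ h

theorem exists_strategyValue_minV (G : SSG V) (σ : G.MaxStrategy) {x : V}
    (h : G.kind x = .minV) : ∃ y ∈ G.succ x, G.strategyValue σ y = G.strategyValue σ x := by
  obtain ⟨τ, hτ⟩ := G.exists_isBestResponse σ
  rw [← hτ.value_eq]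
  exact ⟨_, (τ ⟨x, h⟩).2, (G.value_minV σ τ h).symm⟩

theorem isSupersolution_strategyValue (G : SSG V) (σ : G.MaxStrategy) :
    G.IsSupersolution σ (G.strategyValue σ) where
  payoff_le := G.payoff_le_strategyValue σ
  maxV _ h := (G.strategyValue_maxV σ h).ge
  minV _ h := (G.exists_strategyValue_minV σ h).imp fun _ hy => ⟨hy.1, hy.2.le⟩
  random _ h := (G.strategyValue_random σ h).ge

/-- If the value at `y` were smaller, lowering the value at `x` to it would leave a supersolution
below `v_σ`. -/
theorem strategyValue_minV_le (G : SSG V) (σ : G.MaxStrategy) {x y : V} (h : G.kind x = .minV)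
    (hy : y ∈ G.succ x) : G.strategyValue σ x ≤ G.strategyValue σ y := by
  classical
  by_contra! hlt
  set v := G.strategyValue σ
  let f := Function.update v x (v y)
  have hfv : f ≤ v := by
    intro z
    by_cases hz : z = x
    · subst hz
      simpa [f] using hlt.le
    · simp [f, hz]
  have hS := G.isSupersolution_strategyValue σ
  have hf : ∀ z, z ≠ x → f z = v z := fun z hz => by simp [f, hz]
  have hfx : f x = v y := by simp [f]
  have : G.IsSupersolution σ f := by
    refine ⟨fun z => ?_, fun z hz => ?_, fun z hz => ?_, fun z hz => ?_⟩
    · by_cases hzx : z = x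
      · rw [hzx, hfx, G.payoff_of_ne (by simp [h])]
        exact (G.strategyValue_mem σ y).1
      · rw [hf z hzx]
        exact hS.payoff_le z
    · rw [hf z (by rintro rfl; simp [h] at hz)]
      exact (hfv _).trans (hS.maxV z hz)
    · by_cases hzx : z = x
      · rw [hzx, hfx]
        exact ⟨y, hy, hfv y⟩
      · rw [hf z hzx]
        exact (hS.minV z hz).imp fun w hw => ⟨hw.1, (hfv w).trans hw.2⟩
    · rw [hf z (by rintro rfl; simp [h] at hz)]
      exact (expect_mono _ fun w _ => hfv w).trans (hS.random z hz)
  have := this.strategyValue_le x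
  rw [hfx] at this
  exact this.not_gt hlt

/-- The value is `0` on a set without sinks that the play cannot leave. -/
theorem value_eq_zero_of_closed (G : SSG V) (σ : G.MaxStrategy) (τ : G.MinStrategy) {M : Set V}
    (hs : ∀ x ∈ M, G.kind x ≠ .sink) (hM : ∀ x ∈ M, (G.step σ τ x).support ⊆ M) {x : V}
    (hx : x ∈ M) : G.value σ τ x = 0 := by
  classical
  -- The indicator of the complement is superharmonic because the set is closed, and it bounds the
  -- payoff because the set has no sinks.
  let f : V → ℝ := fun y => if y ∈ M then 0 else 1
  have hf1 : ∀ y, f y ≤ 1 := fun y => by simp only [f]; split_ifs <;> simp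
  have : G.value σ τ ≤ f := by
    refine G.value_le_of_transition_le σ τ (fun y => ?_) fun y => ?_
    · by_cases hy : y ∈ M
      · simp [f, hy, G.payoff_of_ne (hs y hy)]
      · simpa [f, hy] using (G.payoff_mem y).2
    · by_cases hy : y ∈ M
      · simp only [f, hy, if_true]
        exact expect_le _ fun z hz => by simp [hM y hy hz]
      · simp only [f, hy, if_false]
        exact expect_le _ fun z _ => hf1 z
  refine le_antisymm ((this x).trans ?_) (G.value_mem σ τ x).1
  simp [f, hx]

/-! ### Values in the transformed game -/

section Fix

variable (G : SSG V) (A : Set (V × V)) (f : A → Set.Icc (0 : ℝ) 1)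

theorem value_fix_inr (σ : (G.fix A f).MaxStrategy) (τ : (G.fix A f).MinStrategy) (e : A) :
    (G.fix A f).value σ τ (Sum.inr e) = f e :=
  (G.fix A f).value_sink σ τ (x := Sum.inr e) rfl

theorem value_fix_random (σ : (G.fix A f).MaxStrategy) (τ : (G.fix A f).MinStrategy) {x : V}
    (h : G.kind x = .random) : (G.fix A f).value σ τ (Sum.inl x) =
      expect (G.prob x) fun y => (G.fix A f).value σ τ (redirect A x y) := by
  rw [(G.fix A f).value_random σ τ (x := Sum.inl x) h]
  exact expect_map _ _ _

theorem value_fix_maxV (σ : G.MaxStrategy) (τ : (G.fix A f).MinStrategy) {x : V}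
    (h : G.kind x = .maxV) : (G.fix A f).value (G.liftMax A f σ) τ (Sum.inl x) =
      (G.fix A f).value (G.liftMax A f σ) τ (redirect A x (σ ⟨x, h⟩).1) :=
  (G.fix A f).value_maxV (G.liftMax A f σ) τ (x := Sum.inl x) h

theorem value_fix_minV (σ : (G.fix A f).MaxStrategy) (τ : G.MinStrategy) {x : V}
    (h : G.kind x = .minV) : (G.fix A f).value σ (G.liftMin A f τ) (Sum.inl x) =
      (G.fix A f).value σ (G.liftMin A f τ) (redirect A x (τ ⟨x, h⟩).1) :=
  (G.fix A f).value_minV σ (G.liftMin A f τ) (x := Sum.inl x) h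

/-- For superharmonicity in `G[A, f]`, only the redirected arcs matter. -/
theorem value_fix_le (σ : G.MaxStrategy) (τ : G.MinStrategy) {g : V → ℝ} (h₀ : G.payoff ≤ g)
    (hmax : ∀ x (h : G.kind x = .maxV), extend A f g (redirect A x (σ ⟨x, h⟩).1) ≤ g x)
    (hmin : ∀ x (h : G.kind x = .minV), extend A f g (redirect A x (τ ⟨x, h⟩).1) ≤ g x)
    (hr : ∀ x, G.kind x = .random →
      expect (G.prob x) (fun y => extend A f g (redirect A x y)) ≤ g x) :
    (G.fix A f).value (G.liftMax A f σ) (G.liftMin A f τ) ≤ extend A f g := by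
  refine (G.fix A f).value_le_of_transition_le _ _ ?_ ((G.fix A f).transition_le _ _ ?_ ?_ ?_)
  · rintro (x | e)
    · exact h₀ x
    · exact (G.payoff_fix_inr A f e).le
  · rintro (x | e) h
    · exact hmax x h
    · cases h
  · rintro (x | e) h
    · exact hmin x h
    · cases h
  · rintro (x | e) h
    · refine le_trans (le_of_eq ?_) (hr x h)
      exact expect_map _ _ _
    · cases h

theorem strategyValue_fix (σ : G.MaxStrategy) :
    (G.fix A (G.arcValue A σ)).strategyValue (G.liftMax A (G.arcValue A σ) σ) =
      extend A (G.arcValue A σ) (G.strategyValue σ) := by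
  set v := G.strategyValue σ with hv
  set F := G.fix A (G.arcValue A σ)
  refine le_antisymm ?_ ?_
  · obtain ⟨τ, hτ⟩ := G.exists_isBestResponse σ
    refine (F.strategyValue_le_value _ (G.liftMin A _ τ)).trans ?_
    refine G.value_fix_le A _ σ τ (G.payoff_le_strategyValue σ) ?_ ?_ ?_
    · intro x h
      rw [extend_arcValue_redirect, hv, ← G.strategyValue_maxV σ h]
    · intro x h
      rw [extend_arcValue_redirect, hv, ← hτ.value_eq, ← G.value_minV σ τ h]
    · intro x h
      simp only [extend_arcValue_redirect, hv, ← G.strategyValue_random σ h, le_refl]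
  · obtain ⟨τ, hτ⟩ := F.exists_isBestResponse (G.liftMax A _ σ)
    rw [← hτ.value_eq]
    set u := F.value (G.liftMax A _ σ) τ
    -- The values in the transformed game need not be a supersolution in `G`, since a redirected arc
    -- only controls `v`. The minimum with `v` is one, so `v ≤ m ≤ u`.
    let m : V → ℝ := fun x => min (u (Sum.inl x)) (v x)
    have hm : ∀ x y, m y ≤ u (redirect A x y) := by
      intro x y
      unfold redirect
      split_ifs with h
      · exact (min_le_right _ _).trans (G.value_fix_inr A _ _ τ ⟨(x, y), h⟩).ge
      · exact min_le_left _ _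
    have hS := G.isSupersolution_strategyValue σ
    have : G.IsSupersolution σ m := by
      refine ⟨fun x => ?_, fun x h => ?_, fun x h => ?_, fun x h => ?_⟩
      · exact le_min (F.payoff_le_value _ τ (Sum.inl x)) (hS.payoff_le x)
      · refine le_min ?_ ((min_le_right _ _).trans (hS.maxV x h))
        exact (hm x _).trans (G.value_fix_maxV A _ σ τ h).ge
      · rcases min_choice (u (Sum.inl x)) (v x) with h' | h'
        · obtain ⟨y, hy, hyz⟩ := G.exists_of_mem_fix_succ A (G.arcValue A σ) (by simp [h])
            (τ ⟨Sum.inl x, h⟩).2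
          refine ⟨y, hy, ?_⟩
          change m y ≤ min _ _
          rw [h']
          refine (hm x y).trans ?_
          rw [hyz]
          exact (F.value_minV _ τ (x := Sum.inl x) h).ge
        · obtain ⟨y, hy, hyx⟩ := hS.minV x h
          refine ⟨y, hy, ?_⟩
          change m y ≤ min _ _
          rw [h']
          exact (min_le_right _ _).trans hyx
      · refine le_min ?_ ((expect_mono _ fun _ _ => min_le_right _ _).trans (hS.random x h))
        exact (expect_mono _ fun y _ => hm x y).trans (G.value_fix_random A _ _ τ h).ge
    have hvm := this.strategyValue_le
    rintro (x | e)
    · exact (hvm x).trans (min_le_left _ _)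
    · exact (G.value_fix_inr A _ _ τ e).ge

end Fix

/-! ### Improvement in the transformed game -/

/-- Otherwise `v_σ` would be superharmonic for `σ'` and a best response to `σ`, and the values of
`σ'` in the transformed game could not exceed it. -/
theorem ImprovesIn.exists_gain {G : SSG V} {A : Set (V × V)} {σ σ' : G.MaxStrategy}
    (h : G.ImprovesIn A σ' σ) :
    ∃ x, ∃ hx : G.kind x = .maxV, G.strategyValue σ x < G.strategyValue σ (σ' ⟨x, hx⟩).1 := by
  by_contra! hle
  obtain ⟨τ, hτ⟩ := G.exists_isBestResponse σ
  have key := G.value_fix_le A (G.arcValue A σ) σ' τ (G.payoff_le_strategyValue σ)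
    (fun x hx => by
      rw [extend_arcValue_redirect]
      exact hle x hx)
    (fun x hx => by
      rw [extend_arcValue_redirect, ← hτ.value_eq, ← G.value_minV σ τ hx])
    (fun x hx => by
      simp only [extend_arcValue_redirect, ← G.strategyValue_random σ hx, le_refl])
  rw [← strategyValue_fix] at key
  exact h.1.not_ge (((G.fix A _).strategyValue_le_value _ _).trans key)

theorem le_value_redirect {G : SSG V} {A : Set (V × V)} {σ σ' : G.MaxStrategy}
    (h : G.ImprovesIn A σ' σ) (τ : (G.fix A (G.arcValue A σ)).MinStrategy) (x : V) :
    G.strategyValue σ x ≤ (G.fix A (G.arcValue A σ)).value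
      (G.liftMax A (G.arcValue A σ) σ') τ (Sum.inl x) := by
  refine le_trans ?_ ((h.1.le (Sum.inl x)).trans ((G.fix A _).strategyValue_le_value _ τ _))
  rw [strategyValue_fix]
  rfl

/-- Fix a best response `τ` to `σ'` in `G` and let `u` be the values of the lifted pair in the
transformed game; `v ≤ u` there. If `u` exceeds the value in `G`, the set `M` where the excess has
its maximum `m > 0` has no sinks and is closed under `(σ', τ)`. So the value in `G` vanishes on `M`,
and `u = m` there. If `v` never equals `m` on `M`, no redirected arc is used and `u` vanishes too.
Otherwise `(σ, τ)` is trapped in the part of `M` where `v = m`, forcing `v ≤ 0` there. -/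
theorem ImprovesIn.strategyValue_le {G : SSG V} {A : Set (V × V)} {σ σ' : G.MaxStrategy}
    (h : G.ImprovesIn A σ' σ) : G.strategyValue σ ≤ G.strategyValue σ' := by
  obtain ⟨τ, hτ⟩ := G.exists_isBestResponse σ'
  rw [← hτ.value_eq]
  set v := G.strategyValue σ with hv
  set F := G.fix A (G.arcValue A σ)
  set u := F.value (G.liftMax A _ σ') (G.liftMin A _ τ) with hu
  have hvu : ∀ x, v x ≤ u (Sum.inl x) := le_value_redirect h _
  have hru : ∀ x y, u (redirect A x y) ≤ u (Sum.inl y) := by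
    intro x y
    unfold redirect
    split_ifs with hA
    · exact (G.value_fix_inr A _ _ _ ⟨(x, y), hA⟩).le.trans (hvu y)
    · exact le_rfl
  have hstep : ∀ x, G.kind x ≠ .sink →
      u (Sum.inl x) = expect (G.step σ' τ x) fun y => u (redirect A x y) := by
    intro x hx
    cases hk : G.kind x
    · rw [G.step_maxV σ' τ hk, expect_pure]
      exact G.value_fix_maxV A _ σ' _ hk
    · rw [G.step_minV σ' τ hk, expect_pure]
      exact G.value_fix_minV A _ _ τ hk
    · rw [G.step_random σ' τ hk]
      exact G.value_fix_random A _ _ _ hk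
    · exact absurd hk hx
  suffices hle : ∀ x, u (Sum.inl x) ≤ G.value σ' τ x from fun x => (hvu x).trans (hle x)
  by_contra! hcon
  obtain ⟨x₁, hx₁⟩ := hcon
  let d : V → ℝ := fun x => u (Sum.inl x) - G.value σ' τ x
  have : Nonempty V := ⟨x₁⟩
  obtain ⟨x₀, hx₀⟩ := Finite.exists_max d
  set m := d x₀
  have hm : 0 < m := (sub_pos.2 hx₁).trans_le (hx₀ x₁)
  let M : Set V := {x | d x = m}
  have hMs : ∀ x ∈ M, G.kind x ≠ .sink := by
    intro x hx hs
    have h1 : u (Sum.inl x) = G.val x := F.value_sink _ _ (x := Sum.inl x) hs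
    have h2 := G.value_sink σ' τ hs
    have : d x = 0 := by simp only [d, h1, h2, sub_self]
    exact hm.ne' (hx.symm.trans this)
  have hMd : ∀ x ∈ M, m ≤ expect (G.step σ' τ x) fun y => u (redirect A x y) - G.value σ' τ y := by
    intro x hx
    rw [expect_sub, ← hstep x (hMs x hx)]
    have := congrFun (G.transition_value σ' τ) x
    rw [transition] at this
    rw [this]
    exact (hx : d x = m).ge
  have hle : ∀ x y, u (redirect A x y) - G.value σ' τ y ≤ d y := fun x y =>
    sub_le_sub_right (hru x y) _
  have hMred : ∀ x ∈ M, ∀ y ∈ (G.step σ' τ x).support,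
      u (redirect A x y) - G.value σ' τ y = m := fun x hx =>
    eq_of_le_expect _ (fun y _ => (hle x y).trans (hx₀ y)) (hMd x hx)
  have hMcl : ∀ x ∈ M, (G.step σ' τ x).support ⊆ M := fun x hx y hy =>
    le_antisymm (hx₀ y) ((hMred x hx y hy).ge.trans (hle x y))
  have hM0 : ∀ x ∈ M, G.value σ' τ x = 0 := fun x hx => G.value_eq_zero_of_closed σ' τ hMs hMcl hx
  have hMu : ∀ x ∈ M, u (Sum.inl x) = m := by
    intro x hx
    have : d x = m := hx
    simpa only [d, hM0 x hx, sub_zero] using this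
  have hMv : ∀ x ∈ M, v x ≤ m := fun x hx => (hvu x).trans (hMu x hx).le
  obtain ⟨x₂, hx₂, hvx₂⟩ : ∃ x ∈ M, v x = m := by
    by_contra! hne
    -- A redirected arc out of `M` would end in a sink of value `v y`, which would have to equal
    -- `m`.
    have hAM : ∀ x ∈ M, ∀ y ∈ (G.step σ' τ x).support, (x, y) ∉ A := by
      intro x hx y hy hA
      have hyM := hMcl x hx hy
      have h1 := hMred x hx y hy
      rw [hM0 y hyM, sub_zero, redirect, dif_pos hA] at h1
      exact hne y hyM ((G.value_fix_inr A _ _ _ ⟨(x, y), hA⟩).symm.trans h1)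
    have h0 : u (Sum.inl x₀) = 0 := by
      refine F.value_eq_zero_of_closed _ _ (M := Sum.inl '' M) ?_ ?_ ⟨x₀, rfl, rfl⟩
      · rintro _ ⟨x, hx, rfl⟩
        exact hMs x hx
      · rintro _ ⟨x, hx, rfl⟩ z hz
        have hred : ∀ y ∈ (G.step σ' τ x).support, redirect A x y ∈ Sum.inl '' M := by
          intro y hy
          rw [redirect, dif_neg (hAM x hx y hy)]
          exact ⟨y, hMcl x hx hy, rfl⟩
        cases hk : G.kind x
        · rw [F.step_maxV _ _ (x := Sum.inl x) hk, PMF.support_pure] at hz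
          rw [Set.mem_singleton_iff.1 hz]
          exact hred _ (by simp [G.step_maxV σ' τ hk])
        · rw [F.step_minV _ _ (x := Sum.inl x) hk, PMF.support_pure] at hz
          rw [Set.mem_singleton_iff.1 hz]
          exact hred _ (by simp [G.step_minV σ' τ hk])
        · rw [F.step_random _ _ (x := Sum.inl x) hk] at hz
          change z ∈ ((G.prob x).map (redirect A x)).support at hz
          rw [PMF.support_map] at hz
          obtain ⟨y, hy, rfl⟩ := hz
          exact hred y (by rwa [G.step_random σ' τ hk])
        · exact absurd hk (hMs x hx)
    exact hm.ne' ((hMu x₀ rfl).symm.trans h0)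
  have hzero : G.value σ τ x₂ = 0 := by
    refine G.value_eq_zero_of_closed σ τ (M := {x | x ∈ M ∧ v x = m}) (fun x hx => hMs x hx.1) ?_
      ⟨hx₂, hvx₂⟩
    rintro x ⟨hx, hvx⟩
    have hcl := hMcl x hx
    cases hk : G.kind x
    -- At `x` the value in the transformed game is squeezed between `v x` and `m`, which coincide,
    -- so the improvement keeps the strategy at `x`.
    · have hσ : σ' ⟨x, hk⟩ = σ ⟨x, hk⟩ := by
        have heq : F.strategyValue (G.liftMax A _ σ') (Sum.inl x) =
            F.strategyValue (G.liftMax A _ σ) (Sum.inl x) := by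
          refine le_antisymm ?_ (h.1.le _)
          refine (F.strategyValue_le_value _ (G.liftMin A _ τ) _).trans ?_
          rw [strategyValue_fix]
          exact (hMu x hx).le.trans hvx.ge
        have := congrArg Subtype.val (h.2 ⟨Sum.inl x, hk⟩ heq)
        exact Subtype.ext (redirect_injective A x this)
      rw [G.step_maxV σ' τ hk, hσ, PMF.support_pure, Set.singleton_subset_iff] at hcl
      rw [G.step_maxV σ τ hk, PMF.support_pure, Set.singleton_subset_iff]
      exact ⟨hcl, (G.strategyValue_maxV σ hk).symm.trans hvx⟩
    · rw [G.step_minV σ' τ hk, PMF.support_pure, Set.singleton_subset_iff] at hcl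
      rw [G.step_minV σ τ hk, PMF.support_pure, Set.singleton_subset_iff]
      exact ⟨hcl, le_antisymm (hMv _ hcl)
        (hvx.ge.trans (G.strategyValue_minV_le σ hk (τ ⟨x, hk⟩).2))⟩
    · rw [G.step_random σ' τ hk] at hcl
      rw [G.step_random σ τ hk]
      exact fun y hy => ⟨hcl hy, eq_of_le_expect _ (fun z hz => hMv z (hcl hz))
        (hvx.ge.trans (G.strategyValue_random σ hk).le) y hy⟩
    · exact absurd hk (hMs x hx)
  exact hm.not_ge (hvx₂.ge.trans ((G.strategyValue_le_value σ τ x₂).trans hzero.le))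

end SSG

/-! ### Determinants of substochastic matrices -/

open Matrix in
-- Gaussian elimination of the first column: the pivot `1 - A 0 0` lies in [0,1], and the Schur
-- complement is again one minus a substochastic matrix, `A'`. If the pivot is zero, so is the whole
-- first row.
theorem Matrix.det_one_sub_mem_Icc {n : ℕ} (A : Matrix (Fin n) (Fin n) ℝ) (h₀ : ∀ i j, 0 ≤ A i j)
    (h₁ : ∀ i, ∑ j, A i j ≤ 1) : (1 - A).det ∈ Set.Icc (0 : ℝ) 1 := by
  induction n with
  | zero => simp
  | succ n ih =>
    have hsum : ∀ i, A i 0 + ∑ j : Fin n, A i j.succ ≤ 1 := fun i => by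
      rw [← Fin.sum_univ_succ]
      exact h₁ i
    have hrest : ∀ i, 0 ≤ ∑ j : Fin n, A i j.succ := fun i => Finset.sum_nonneg fun j _ => h₀ _ _
    rcases (show A 0 0 ≤ 1 by linarith [hsum 0, hrest 0]).eq_or_lt with h00 | h00
    · have hz : ∀ j : Fin n, A 0 j.succ = 0 := fun j =>
        (Finset.sum_eq_zero_iff_of_nonneg fun j _ => h₀ 0 (Fin.succ j)).1
          (le_antisymm (by linarith [hsum 0]) (hrest 0)) j (Finset.mem_univ j)
      rw [Matrix.det_eq_zero_of_row_eq_zero 0 fun j => ?_]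
      · simp
      · refine Fin.cases ?_ (fun j => ?_) j
        · simp [h00]
        · simp [hz, (Fin.succ_ne_zero j).symm]
    · have hpos : 0 < 1 - A 0 0 := sub_pos.2 h00
      let c : Fin (n + 1) → ℝ := fun i => if i = 0 then 0 else A i 0 / (1 - A 0 0)
      let B : Matrix (Fin (n + 1)) (Fin (n + 1)) ℝ := fun i j => (1 - A) i j + c i * (1 - A) 0 j
      let A' : Matrix (Fin n) (Fin n) ℝ := fun i j =>
        A i.succ j.succ + A i.succ 0 / (1 - A 0 0) * A 0 j.succ
      have hB : (1 - A).det = B.det :=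
        Matrix.det_eq_of_forall_row_eq_smul_add_const (fun i => - c i) 0 (by simp [c]) fun i j => by
          simp [B, c]
      have hcol : ∀ i : Fin n, B i.succ 0 = 0 := fun i => by
        simp only [B, c, Matrix.sub_apply, Matrix.one_apply_eq, Fin.succ_ne_zero, if_false]
        rw [Matrix.one_apply_ne (Fin.succ_ne_zero i)]
        field_simp
        ring
      have hsub : B.submatrix (Fin.succAbove 0) Fin.succ = 1 - A' := by
        ext i j
        change (1 - A) i.succ j.succ + c i.succ * (1 - A) 0 j.succ = (1 : Matrix _ _ ℝ) i j - A' i j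
        simp only [c, A', Matrix.sub_apply, Fin.succ_ne_zero, if_false, Matrix.one_apply,
          Fin.succ_inj, (Fin.succ_ne_zero j).symm]
        ring
      have hdet : B.det = (1 - A 0 0) * (1 - A').det := by
        rw [Matrix.det_succ_column_zero, Fin.sum_univ_succ, Finset.sum_eq_zero, hsub]
        · simp [B, c]
        · intro i _
          rw [hcol]
          simp
      obtain ⟨hd0, hd1⟩ := ih A' (fun i j => add_nonneg (h₀ _ _)
        (mul_nonneg (div_nonneg (h₀ _ _) hpos.le) (h₀ _ _))) fun i => by
          simp only [A', Finset.sum_add_distrib, ← Finset.mul_sum]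
          have h2 : A i.succ 0 / (1 - A 0 0) * ∑ j : Fin n, A 0 j.succ ≤ A i.succ 0 := by
            rw [div_mul_eq_mul_div, div_le_iff₀ hpos]
            exact mul_le_mul_of_nonneg_left (by linarith [hsum 0]) (h₀ _ _)
          linarith [hsum i.succ]
      rw [hB, hdet]
      exact ⟨mul_nonneg hpos.le hd0, mul_le_one₀ (by linarith [h₀ 0 0]) hd0 hd1⟩

theorem Matrix.det_diagonal_sub_le {ι : Type*} [Fintype ι] [DecidableEq ι] (L : Matrix ι ι ℝ)
    (d : ι → ℝ) (hd : ∀ i, 0 < d i) (h₀ : ∀ i j, 0 ≤ L i j) (h₁ : ∀ i, ∑ j, L i j ≤ d i) :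
    (Matrix.diagonal d - L).det ∈ Set.Icc 0 (∏ i, d i) := by
  let A : Matrix ι ι ℝ := fun i j => L i j / d i
  have hfac : Matrix.diagonal d - L = Matrix.diagonal d * (1 - A) := by
    rw [mul_sub, mul_one]
    congr 1
    ext i j
    rw [Matrix.diagonal_mul, mul_div_cancel₀ _ (hd i).ne']
  let e := Fintype.equivFin ι
  have hA := Matrix.det_one_sub_mem_Icc (Matrix.reindex e e A)
    (fun i j => div_nonneg (h₀ _ _) (hd _).le) fun i => by
      simp only [Matrix.reindex_apply, Matrix.submatrix_apply]
      rw [Equiv.sum_comp e.symm (fun j => A (e.symm i) j)]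
      simp only [A, ← Finset.sum_div]
      exact div_le_one_of_le₀ (h₁ _) (hd _).le
  have hdet : (1 - Matrix.reindex e e A).det = (1 - A).det := by
    rw [← Matrix.det_reindex_self e (1 - A)]
    congr 1
    ext i j
    simp [Matrix.one_apply]
  rw [hdet] at hA
  have hP : 0 < ∏ i, d i := Finset.prod_pos fun i _ => hd i
  rw [hfac, Matrix.det_mul, Matrix.det_diagonal]
  exact ⟨mul_nonneg hP.le hA.1, mul_le_of_le_one_right hP.le hA.2⟩

namespace SSG

variable {V : Type u}

/-! ### The common denominator of the values -/

theorem IsQSSG.val_eq {G : SSG V} {q : ℕ} (hG : G.IsQSSG q) {x : V} (h : G.kind x = .sink) :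
    G.val x = 0 ∨ G.val x = 1 := by
  obtain ⟨⟨s₀, s₁, h₀, h₁, hs⟩, -⟩ := hG
  rcases (hs x).1 h with rfl | rfl
  · exact Or.inl h₀
  · exact Or.inr h₁

open Classical in
-- Vertices that are not random have denominator one, so the product of all denominators is at most
-- q^r.
theorem IsQSSG.exists_step_eq_div {G : SSG V} {q : ℕ} (hG : G.IsQSSG q) (σ : G.MaxStrategy)
    (τ : G.MinStrategy) (x : V) : ∃ d : ℕ, 0 < d ∧ d ≤ (if G.kind x = .random then q else 1) ∧
      ∃ l : V → ℕ, ∀ y, (d : ℝ) * (G.step σ τ x y).toReal = l y := by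
  by_cases h : G.kind x = .random
  · obtain ⟨d, hd, hdq, l, hl⟩ := hG.2 x h
    refine ⟨d, hd, by simpa [h] using hdq, l, fun y => ?_⟩
    rw [G.step_random σ τ h, hl, mul_div_cancel₀ _ (by positivity)]
  · obtain ⟨z, hz⟩ : ∃ z, G.step σ τ x = PMF.pure z := by
      cases hk : G.kind x
      · exact ⟨_, G.step_maxV σ τ hk⟩
      · exact ⟨_, G.step_minV σ τ hk⟩
      · exact absurd hk h
      · exact ⟨_, G.step_sink σ τ hk⟩
    refine ⟨1, one_pos, by simp [h], fun y => if y = z then 1 else 0, fun y => ?_⟩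
    rw [hz, PMF.pure_apply]
    split_ifs <;> simp_all

variable [Finite V]

/-- Cramer's rule for the linear system of the values, with each row multiplied by its denominator;
`D` is the determinant of the resulting integer matrix. -/
theorem IsQSSG.exists_denominator {G : SSG V} {q : ℕ} (hG : G.IsQSSG q) (σ : G.MaxStrategy)
    (τ : G.MinStrategy) : ∃ D : ℕ, 0 < D ∧ D ≤ q ^ G.numRandom ∧
      ∀ x, ∃ k : ℤ, (D : ℝ) * G.value σ τ x = k := by
  classical
  have := Fintype.ofFinite V
  choose d hd hdq l hl using hG.exists_step_eq_div σ τ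
  set v := G.value σ τ with hv
  -- The full harmonic system is singular in general: sinks and closed sets without sinks give null
  -- vectors. Inactive rows prescribe the known value instead.
  let active : V → Prop := fun x => G.kind x ≠ .sink ∧ v x ≠ 0
  have hlexp : ∀ x (f : V → ℝ), ∑ y, (l x y : ℝ) * f y = d x * expect (G.step σ τ x) f := by
    intro x f
    rw [expect_eq_sum, Finset.mul_sum]
    exact Finset.sum_congr rfl fun y _ => by rw [← hl, mul_assoc]
  let L : Matrix V V ℤ := fun x y => if active x then (l x y : ℤ) else 0
  let N : Matrix V V ℤ := Matrix.diagonal (fun x => (d x : ℤ)) - L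
  let L' : Matrix V V ℝ := fun x y => if active x then (l x y : ℝ) else 0
  let N' : Matrix V V ℝ := Matrix.diagonal (fun x => (d x : ℝ)) - L'
  have hNN : (Int.castRingHom ℝ).mapMatrix N = N' := by
    ext x y
    change (Int.castRingHom ℝ) (Matrix.diagonal (fun x => (d x : ℤ)) x y -
      if active x then (l x y : ℤ) else 0) =
      Matrix.diagonal (fun x => (d x : ℝ)) x y - if active x then (l x y : ℝ) else 0
    rw [Matrix.diagonal_apply, Matrix.diagonal_apply]
    split_ifs <;> simp
  have hL' : ∀ x (f : V → ℝ), ∑ y, L' x y * f y =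
      if active x then d x * expect (G.step σ τ x) f else 0 := by
    intro x f
    by_cases hx : active x
    · simp only [L', hx, if_true, hlexp]
    · simp only [L', hx, if_false, zero_mul, Finset.sum_const_zero]
  have hmul : ∀ (f : V → ℝ) x, N'.mulVec f x =
      d x * f x - if active x then d x * expect (G.step σ τ x) f else 0 := by
    intro f x
    rw [Matrix.sub_mulVec, Pi.sub_apply, Matrix.mulVec_diagonal, ← hL']
    rfl
  have hd' : ∀ x, (0 : ℝ) < d x := fun x => Nat.cast_pos.2 (hd x)
  have hdet := Matrix.det_diagonal_sub_le L' (fun x => (d x : ℝ)) hd'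
    (fun x y => by simp only [L']; split_ifs <;> positivity) fun x => by
      have := hL' x fun _ => 1
      simp only [mul_one, expect_const] at this
      rw [this]
      split_ifs
      · exact le_rfl
      · exact (hd' x).le
  change N'.det ∈ _ at hdet
  -- The vertices where a null vector has maximal modulus are active and form a closed set, so their
  -- value is zero, against the definition of active.
  have hne : N'.det ≠ 0 := by
    intro h0
    obtain ⟨w, hw0, hw⟩ := Matrix.exists_mulVec_eq_zero_iff.2 h0
    have hrow : ∀ x, w x = if active x then expect (G.step σ τ x) w else 0 := by
      intro x
      have := (hmul w x).symm.trans (congrFun hw x)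
      split_ifs at this ⊢
      · exact mul_left_cancel₀ (hd' x).ne' (sub_eq_zero.1 this)
      · simpa [(hd' x).ne'] using this
    obtain ⟨x₁, hx₁⟩ := Function.ne_iff.1 hw0
    have : Nonempty V := ⟨x₁⟩
    obtain ⟨x₀, hx₀⟩ := Finite.exists_max fun x => |w x|
    have hm : 0 < |w x₀| := (abs_pos.2 hx₁).trans_le (hx₀ x₁)
    have hact : ∀ x ∈ {x | |w x| = |w x₀|}, active x := by
      intro x hx
      by_contra hna
      have := hrow x
      rw [if_neg hna] at this
      rw [Set.mem_ofPred_eq, this, abs_zero] at hx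
      exact hm.ne hx
    refine (hact x₀ rfl).2 (G.value_eq_zero_of_closed σ τ (fun x hx => (hact x hx).1)
      (fun x hx => ?_) (x := x₀) rfl)
    refine eq_of_le_expect (G.step σ τ x) (fun y _ => hx₀ y) ?_
    have hwx := hrow x
    rw [if_pos (hact x hx)] at hwx
    rw [← (hx : |w x| = |w x₀|), hwx, expect_eq_sum, expect_eq_sum]
    refine (Finset.abs_sum_le_sum_abs _ _).trans_eq (Finset.sum_congr rfl fun y _ => ?_)
    rw [abs_mul, abs_of_nonneg ENNReal.toReal_nonneg]
  have hcast : (N.det : ℝ) = N'.det := by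
    rw [← hNN, ← RingHom.map_det]
    rfl
  have hprod : ∏ x, (d x : ℝ) ≤ (q : ℝ) ^ G.numRandom := by
    rw [numRandom, Nat.card_eq_fintype_card, Fintype.card_subtype]
    calc ∏ x, (d x : ℝ) ≤ ∏ x, if G.kind x = .random then (q : ℝ) else 1 := by
          refine Finset.prod_le_prod (fun x _ => (hd' x).le) fun x _ => ?_
          have : (d x : ℝ) ≤ ((if G.kind x = .random then q else 1 : ℕ) : ℝ) :=
            Nat.cast_le.2 (hdq x)
          simpa using this
      _ = _ := by rw [Finset.prod_ite, Finset.prod_const, Finset.prod_const_one, mul_one]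
  have hpos : 0 < N.det := by
    have : (0 : ℝ) < N.det := hcast ▸ lt_of_le_of_ne hdet.1 hne.symm
    exact_mod_cast this
  have hDr : ((N.det.toNat : ℕ) : ℝ) = N'.det := by
    rw [← hcast, ← Int.cast_natCast, Int.toNat_of_nonneg hpos.le]
  refine ⟨N.det.toNat, by omega, ?_, ?_⟩
  · have : ((N.det.toNat : ℕ) : ℝ) ≤ ((q ^ G.numRandom : ℕ) : ℝ) := by
      rw [hDr, Nat.cast_pow]
      exact hdet.2.trans hprod
    exact_mod_cast this
  · have hb : ∀ x, ∃ b : ℤ, N'.mulVec v x = b := by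
      intro x
      rw [hmul]
      by_cases hx : active x
      · refine ⟨0, ?_⟩
        have : expect (G.step σ τ x) v = v x := congrFun (G.transition_value σ τ) x
        rw [if_pos hx, this, sub_self, Int.cast_zero]
      · rw [if_neg hx, sub_zero]
        by_cases hv0 : v x = 0
        · exact ⟨0, by rw [hv0, mul_zero, Int.cast_zero]⟩
        · have hs : G.kind x = .sink := by
            by_contra hs
            exact hx ⟨hs, hv0⟩
          have hv1 : v x = G.val x := G.value_sink σ τ hs
          rcases hG.val_eq hs with h | h
          · exact absurd (hv1.trans h) hv0
          · exact ⟨d x, by rw [hv1, h, mul_one, Int.cast_natCast]⟩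
    choose b hb using hb
    intro x
    refine ⟨N.adjugate.mulVec b x, ?_⟩
    have h1 : N'.adjugate.mulVec (N'.mulVec v) = N'.det • v := by
      rw [Matrix.mulVec_mulVec, Matrix.adjugate_mul, Matrix.smul_mulVec, Matrix.one_mulVec]
    have h2 := congrFun h1 x
    rw [Pi.smul_apply, smul_eq_mul] at h2
    rw [hDr, ← h2, ← hNN, ← RingHom.map_adjugate, hNN]
    simp only [Matrix.mulVec, dotProduct] at hb ⊢
    rw [Int.cast_sum]
    refine Finset.sum_congr rfl fun y _ => ?_
    rw [hb y, Int.cast_mul]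
    rfl

/-- Distinct values of a strategy in a `q`-SSG differ by at least `q ^ (-r)`. -/
theorem IsQSSG.inv_pow_le_sub {G : SSG V} {q : ℕ} (hG : G.IsQSSG q) (σ : G.MaxStrategy) {x y : V}
    (h : G.strategyValue σ x < G.strategyValue σ y) :
    ((q : ℝ) ^ G.numRandom)⁻¹ ≤ G.strategyValue σ y - G.strategyValue σ x := by
  obtain ⟨τ, hτ⟩ := G.exists_isBestResponse σ
  rw [← hτ.value_eq] at h ⊢
  obtain ⟨D, hD, hDq, hk⟩ := hG.exists_denominator σ τ
  obtain ⟨a, ha⟩ := hk x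
  obtain ⟨b, hb⟩ := hk y
  have hD' : (0 : ℝ) < D := Nat.cast_pos.2 hD
  have hab : a < b := by
    have := mul_lt_mul_of_pos_left h hD'
    rw [ha, hb] at this
    exact_mod_cast this
  have hab' : (a : ℝ) + 1 ≤ b := by exact_mod_cast hab
  have hDq' : (D : ℝ) ≤ (q : ℝ) ^ G.numRandom := by exact_mod_cast hDq
  calc ((q : ℝ) ^ G.numRandom)⁻¹ ≤ (D : ℝ)⁻¹ := inv_anti₀ hD' hDq'
    _ ≤ G.value σ τ y - G.value σ τ x := by
      rw [inv_le_iff_one_le_mul₀' hD', mul_sub, ha, hb]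
      linarith

end SSG

namespace SSG

variable {V : Type u}

/-! ### Responses read off from the order of the values -/

/-- A vertex at which a play of the game without random moves stops. -/
def IsStop (G : SSG V) (x : V) : Prop := G.kind x = .random ∨ G.kind x = .sink

/-- From `x`, the strategies lead to the random vertex or sink `y` without random moves. -/
inductive Leads (G : SSG V) (σ : G.MaxStrategy) (τ : G.MinStrategy) : V → V → Prop
  | base {y : V} (h : G.IsStop y) : Leads G σ τ y y
  | maxV {x y : V} (h : G.kind x = .maxV) (hy : Leads G σ τ (σ ⟨x, h⟩).1 y) : Leads G σ τ x y
  | minV {x y : V} (h : G.kind x = .minV) (hy : Leads G σ τ (τ ⟨x, h⟩).1 y) : Leads G σ τ x y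

theorem Leads.isStop {G : SSG V} {σ : G.MaxStrategy} {τ : G.MinStrategy} {x y : V}
    (h : G.Leads σ τ x y) : G.IsStop y := by
  induction h with
  | base h => exact h
  | maxV _ _ ih => exact ih
  | minV _ _ ih => exact ih

/-- The game in which plays stop on entering a random vertex `y`, with value `w y`. -/
noncomputable abbrev stopped (G : SSG V) (w : V → Set.Icc (0 : ℝ) 1) :
    SSG (V ⊕ G.arcsToRandom) := G.fix G.arcsToRandom fun e => w e.1.2

open Classical in
/-- The value of the stopped game for a play that enters `x`. -/
noncomputable def stoppedValue (G : SSG V) (w : V → Set.Icc (0 : ℝ) 1) (σ : G.MaxStrategy)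
    (τ : G.MinStrategy) (x : V) : ℝ :=
  if G.kind x = .random then w x
  else (G.stopped w).value (G.liftMax _ _ σ) (G.liftMin _ _ τ) (Sum.inl x)

theorem stoppedValue_random (G : SSG V) (w : V → Set.Icc (0 : ℝ) 1) (σ : G.MaxStrategy)
    (τ : G.MinStrategy) {x : V} (h : G.kind x = .random) : G.stoppedValue w σ τ x = w x :=
  if_pos h

variable [Finite V] (G : SSG V) (w : V → Set.Icc (0 : ℝ) 1) (σ : G.MaxStrategy)
  (τ : G.MinStrategy)

theorem value_stopped_redirect {x y : V} (hy : y ∈ G.succ x) :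
    (G.stopped w).value (G.liftMax _ _ σ) (G.liftMin _ _ τ) (redirect G.arcsToRandom x y) =
      G.stoppedValue w σ τ y := by
  unfold stoppedValue redirect
  by_cases h : G.kind y = .random
  · have hA : (x, y) ∈ G.arcsToRandom := ⟨hy, h⟩
    rw [dif_pos hA, if_pos h, value_fix_inr]
  · have hA : (x, y) ∉ G.arcsToRandom := fun hA => h hA.2
    rw [dif_neg hA, if_neg h]

theorem stoppedValue_sink {x : V} (h : G.kind x = .sink) : G.stoppedValue w σ τ x = G.val x := by
  rw [stoppedValue, if_neg (by simp [h])]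
  exact (G.stopped w).value_sink _ _ (x := Sum.inl x) h

theorem stoppedValue_maxV {x : V} (h : G.kind x = .maxV) :
    G.stoppedValue w σ τ x = G.stoppedValue w σ τ (σ ⟨x, h⟩).1 := by
  rw [← G.value_stopped_redirect w σ τ (σ ⟨x, h⟩).2, stoppedValue, if_neg (by simp [h])]
  exact G.value_fix_maxV _ _ σ _ h

theorem stoppedValue_minV {x : V} (h : G.kind x = .minV) :
    G.stoppedValue w σ τ x = G.stoppedValue w σ τ (τ ⟨x, h⟩).1 := by
  rw [← G.value_stopped_redirect w σ τ (τ ⟨x, h⟩).2, stoppedValue, if_neg (by simp [h])]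
  exact G.value_fix_minV _ _ _ τ h

theorem Leads.stoppedValue_eq {G : SSG V} {σ : G.MaxStrategy} {τ : G.MinStrategy} {x y : V}
    (h : G.Leads σ τ x y) {w : V → Set.Icc (0 : ℝ) 1}
    (hw : ∀ s, G.kind s = .sink → (w s : ℝ) = G.val s) : G.stoppedValue w σ τ x = w y := by
  induction h with
  | base h =>
    rcases h with h | h
    · exact G.stoppedValue_random w σ τ h
    · rw [G.stoppedValue_sink w σ τ h, hw _ h]
  | maxV h _ ih => rw [G.stoppedValue_maxV w σ τ h, ih]
  | minV h _ ih => rw [G.stoppedValue_minV w σ τ h, ih]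

theorem stoppedValue_of_not_leads {x : V} (hx : ∀ y, ¬ G.Leads σ τ x y) :
    G.stoppedValue w σ τ x = 0 := by
  have hns : ∀ z, (∀ y, ¬ G.Leads σ τ z y) → ¬ G.IsStop z := fun z hz hs => hz z (.base hs)
  rw [stoppedValue, if_neg fun h => hns x hx (Or.inl h)]
  refine (G.stopped w).value_eq_zero_of_closed _ _
    (M := Sum.inl '' {z | ∀ y, ¬ G.Leads σ τ z y}) ?_ ?_ ⟨x, hx, rfl⟩
  · rintro _ ⟨z, hz, rfl⟩ hs
    exact hns z hz (Or.inr hs)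
  · rintro _ ⟨z, hz, rfl⟩
    have hred : ∀ z', (∀ y, ¬ G.Leads σ τ z' y) →
        redirect G.arcsToRandom z z' ∈ Sum.inl '' {z | ∀ y, ¬ G.Leads σ τ z y} := by
      intro z' hz'
      rw [redirect, dif_neg fun hA => hns z' hz' (Or.inl hA.2)]
      exact ⟨z', hz', rfl⟩
    cases hk : G.kind z
    · rw [(G.stopped w).step_maxV _ _ (x := Sum.inl z) hk, PMF.support_pure,
        Set.singleton_subset_iff]
      exact hred _ fun y hy => hz y (.maxV hk hy)
    · rw [(G.stopped w).step_minV _ _ (x := Sum.inl z) hk, PMF.support_pure,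
        Set.singleton_subset_iff]
      exact hred _ fun y hy => hz y (.minV hk hy)
    · exact absurd (Or.inl hk) (hns z hz)
    · exact absurd (Or.inr hk) (hns z hz)

/-- The stopped game has no random moves: its values are stopping values. -/
theorem exists_stoppedValue_eq {s₀ : V} (hs₀ : G.kind s₀ = .sink) (h₀ : G.val s₀ = 0) (x : V) :
    ∃ y, G.IsStop y ∧ ∀ w : V → Set.Icc (0 : ℝ) 1,
      (∀ s, G.kind s = .sink → (w s : ℝ) = G.val s) → G.stoppedValue w σ τ x = w y := by
  by_cases h : ∃ y, G.Leads σ τ x y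
  · obtain ⟨y, hy⟩ := h
    exact ⟨y, hy.isStop, fun w hw => hy.stoppedValue_eq hw⟩
  · push Not at h
    -- A play that never stops has value 0, as if it stopped in the sink of value 0.
    exact ⟨s₀, Or.inr hs₀, fun w hw => by
      rw [G.stoppedValue_of_not_leads w σ τ h, hw s₀ hs₀, h₀]⟩

/-- Stopped values are values of `w` at vertices that do not depend on `w`, so optimality of `τ` in
the stopped game transfers from `w` to any weights in the same order, here `v_σ` itself. With these
weights the stopped values under `τ` are at most `v_σ`, hence superharmonic in `G`, hence bound the
values of `τ`. -/
theorem IsOrderResponse.isBestResponse {G : SSG V} {v : V → ℝ} {σ : G.MaxStrategy}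
    {τ : G.MinStrategy} (h : G.IsOrderResponse v σ τ) {s₀ : V} (hs₀ : G.kind s₀ = .sink)
    (h₀ : G.val s₀ = 0)
    (hv : ∀ x y, G.IsStop x → G.IsStop y →
      (v x < v y ↔ G.strategyValue σ x < G.strategyValue σ y)) :
    G.IsBestResponse σ τ := by
  obtain ⟨w, hws, hwv, hbest⟩ := h
  obtain ⟨τ', hτ'⟩ := G.exists_isBestResponse σ
  let w' : V → Set.Icc (0 : ℝ) 1 := fun x => ⟨G.strategyValue σ x, G.strategyValue_mem σ x⟩
  have hw's : ∀ s, G.kind s = .sink → (w' s : ℝ) = G.val s := fun s hs =>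
    G.strategyValue_sink σ hs
  have hle : ∀ x, G.stoppedValue w σ τ x ≤ G.stoppedValue w σ τ' x := by
    intro x
    unfold stoppedValue
    split_ifs
    · exact le_rfl
    · exact hbest _ _
  have hle' : ∀ x, G.stoppedValue w' σ τ x ≤ G.stoppedValue w' σ τ' x := by
    intro x
    obtain ⟨y, hy, hyw⟩ := G.exists_stoppedValue_eq σ τ hs₀ h₀ x
    obtain ⟨z, hz, hzw⟩ := G.exists_stoppedValue_eq σ τ' hs₀ h₀ x
    have := hle x
    rw [hyw w hws, hzw w hws] at this
    rw [hyw w' hw's, hzw w' hw's]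
    by_contra! hlt
    exact this.not_gt ((hwv z y hz hy).2 ((hv z y hz hy).2 hlt))
  have hτv : ∀ x, G.stoppedValue w' σ τ' x ≤ G.strategyValue σ x := by
    intro x
    have hred : ∀ x y, extend G.arcsToRandom (fun e => w' e.1.2) (G.strategyValue σ)
        (redirect G.arcsToRandom x y) = G.strategyValue σ y := by
      intro x y
      unfold redirect
      split_ifs <;> rfl
    by_cases hx : G.kind x = .random
    · exact (G.stoppedValue_random w' σ τ' hx).le
    · rw [stoppedValue, if_neg hx]
      refine G.value_fix_le _ _ σ τ' (g := G.strategyValue σ) (G.payoff_le_strategyValue σ)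
        (fun z hz => ?_) (fun z hz => ?_) (fun z hz => ?_) (Sum.inl x)
      · rw [hred, ← G.strategyValue_maxV σ hz]
      · rw [hred, ← hτ'.value_eq, ← G.value_minV σ τ' hz]
      · simp only [hred, ← G.strategyValue_random σ hz, le_refl]
  have hτ : ∀ x, G.stoppedValue w' σ τ x ≤ G.strategyValue σ x := fun x =>
    (hle' x).trans (hτv x)
  refine isBestResponse_of_value_le (le_trans (G.value_le_of_transition_le σ τ (fun x => ?_)
    (G.transition_le σ τ (fun x hx => ?_) (fun x hx => ?_) fun x hx => ?_)) hτ)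
  · by_cases hx : G.kind x = .random
    · rw [G.payoff_of_ne (by simp [hx]), G.stoppedValue_random w' σ τ hx]
      exact (w' x).2.1
    · rw [stoppedValue, if_neg hx]
      exact (G.stopped w').payoff_le_value _ _ (Sum.inl x)
  · exact (G.stoppedValue_maxV w' σ τ hx).ge
  · exact (G.stoppedValue_minV w' σ τ hx).ge
  · rw [G.stoppedValue_random w' σ τ hx]
    exact (expect_mono _ fun y _ => hτ y).trans (G.strategyValue_random σ hx).ge

end SSG

/-! ### Counting rounds -/

/-- The increments at each point are nonnegative and telescope to at most 1, so each point of `S`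
affords at most `1 / δ` gains of size `δ`. -/
theorem sum_card_gain_mul_le {V : Type*} (S : Finset V) (f : ℕ → V → ℝ) (N : ℕ) (δ : ℝ)
    (hmono : ∀ i < N, ∀ x, f i x ≤ f (i + 1) x) (hmem : ∀ i x, f i x ∈ Set.Icc (0 : ℝ) 1) :
    (∑ i ∈ Finset.range N, ({x ∈ S | δ ≤ f (i + 1) x - f i x}.card : ℝ)) * δ ≤ S.card := by
  calc (∑ i ∈ Finset.range N, ({x ∈ S | δ ≤ f (i + 1) x - f i x}.card : ℝ)) * δ
      = ∑ i ∈ Finset.range N, ∑ x ∈ S, if δ ≤ f (i + 1) x - f i x then δ else 0 := by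
        rw [Finset.sum_mul]
        refine Finset.sum_congr rfl fun i _ => ?_
        rw [← Finset.sum_filter, Finset.sum_const, nsmul_eq_mul]
    _ ≤ ∑ i ∈ Finset.range N, ∑ x ∈ S, (f (i + 1) x - f i x) := by
        refine Finset.sum_le_sum fun i hi => Finset.sum_le_sum fun x _ => ?_
        split_ifs with h
        · exact h
        · exact sub_nonneg.2 (hmono i (Finset.mem_range.1 hi) x)
    _ = ∑ x ∈ S, (f N x - f 0 x) := by
        rw [Finset.sum_comm]
        exact Finset.sum_congr rfl fun x _ => Finset.sum_range_sub (fun i => f i x) N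
    _ ≤ ∑ x ∈ S, (1 : ℝ) :=
        Finset.sum_le_sum fun x _ => by linarith [(hmem N x).2, (hmem 0 x).1]
    _ = S.card := by simp

open Classical in
theorem exists_image_image_eq {α : Type*} {S : Finset α} {f g : α → ℝ}
    (h : ∀ x ∈ S, ∀ y ∈ S, g x = g y → f x = f y) : ∃ φ : ℝ → ℝ, ∀ x ∈ S, φ (g x) = f x := by
  refine ⟨fun t => if ht : ∃ x ∈ S, g x = t then f ht.choose else 0, fun x hx => ?_⟩
  have ht : ∃ y ∈ S, g y = g x := ⟨x, hx, rfl⟩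
  simp only [dif_pos ht]
  exact h _ ht.choose_spec.1 _ hx ht.choose_spec.2

theorem Finset.card_image_le_card_image {α : Type*} {S : Finset α} {f g : α → ℝ}
    (h : ∀ x ∈ S, ∀ y ∈ S, g x = g y → f x = f y) : (S.image f).card ≤ (S.image g).card := by
  obtain ⟨φ, hφ⟩ := exists_image_image_eq h
  have : S.image f = (S.image g).image φ := by
    rw [Finset.image_image]
    exact Finset.image_congr fun x hx => (hφ x hx).symm
  rw [this]
  exact Finset.card_image_le

theorem Finset.card_image_lt_card_image {α : Type*} {S : Finset α} {f g : α → ℝ}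
    (h : ∀ x ∈ S, ∀ y ∈ S, g x = g y → f x = f y) {x y : α} (hx : x ∈ S) (hy : y ∈ S)
    (hf : f x = f y) (hg : g x ≠ g y) : (S.image f).card < (S.image g).card := by
  obtain ⟨φ, hφ⟩ := exists_image_image_eq h
  have : S.image f = (S.image g).image φ := by
    rw [Finset.image_image]
    exact Finset.image_congr fun x hx => (hφ x hx).symm
  refine (Finset.card_image_le_card_image h).lt_of_ne fun heq => hg ?_
  rw [this, Finset.card_image_iff] at heq
  refine heq (Finset.mem_coe.2 (Finset.mem_image_of_mem g hx))
    (Finset.mem_coe.2 (Finset.mem_image_of_mem g hy)) ?_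
  rw [hφ x hx, hφ y hy, hf]

namespace SSG

/-! ### Bounds on the prices -/

section Costs

variable {C : Costs} {κ : ℝ} {n r p : ℕ}

theorem Costs.AtLeastQuadratic.pos (h : C.AtLeastQuadratic κ) (hκ : 0 < κ) (hn : 1 ≤ n)
    (hp : 1 ≤ p) : 0 < C.C₁ n p :=
  pos_of_mul_pos_right ((by positivity : (0 : ℝ) < (n : ℝ) ^ 2).trans_le (h.1 n p hn hp)) hκ.le

theorem Costs.AtLeastQuadratic.order_le (h : C.AtLeastQuadratic κ) (hc : 0 < C.c₀) (hr : 1 ≤ r)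
    (hrn : r ≤ n) (hp : 1 ≤ p) :
    C.order n r ≤ 2 * C.c₀ * κ * (C.C₁ n p * r / n) := by
  have hr0 : (1 : ℝ) ≤ r := by exact_mod_cast hr
  have hrn' : (r : ℝ) ≤ n := by exact_mod_cast hrn
  have hn0 : (0 : ℝ) < n := by linarith
  have hlog : Real.log r ≤ n := ((Real.log_le_sub_one_of_pos (by linarith)).trans (by linarith))
  have h1 : (r : ℝ) * Real.log r + n ≤ 2 * (r * n) := by
    have := mul_le_mul_of_nonneg_left hlog (by linarith : (0 : ℝ) ≤ r)
    have := mul_le_mul_of_nonneg_right hr0 hn0.le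
    linarith
  have h2 : (r : ℝ) * n ≤ κ * (C.C₁ n p * r / n) := by
    have h3 := mul_le_mul_of_nonneg_right (h.1 n p (hr.trans hrn) hp) (by positivity : 0 ≤ (r : ℝ) / n)
    calc (r : ℝ) * n = (n : ℝ) ^ 2 * (r / n) := by field_simp
      _ ≤ _ := h3
      _ = _ := by ring
  calc C.order n r ≤ C.c₀ * (2 * (κ * (C.C₁ n p * r / n))) :=
        mul_le_mul_of_nonneg_left (h1.trans (by linarith)) hc.le
    _ = _ := by ring

/-- Quadratic growth yields a factor `(r / n) ^ 2`; one factor `r / n` suffices and the other is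
dropped. -/
theorem Costs.AtLeastQuadratic.C₁_le (h : C.AtLeastQuadratic κ) (hκ : 0 < κ) (hr : 1 ≤ r)
    (hrn : r ≤ n) (hp : 1 ≤ p) : C.C₁ r p ≤ κ * (C.C₁ n p * r / n) := by
  have hr0 : (0 : ℝ) < r := by exact_mod_cast hr
  have hrn' : (r : ℝ) ≤ n := by exact_mod_cast hrn
  have hn0 : (0 : ℝ) < n := by linarith
  have hC := h.pos hκ (hr.trans hrn) hp
  have h1 := h.2 r n p hr hrn hp
  rw [div_le_iff₀ (by positivity)] at h1
  refine h1.trans ?_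
  calc κ * (C.C₁ n p / (n : ℝ) ^ 2) * (r : ℝ) ^ 2 = κ * (C.C₁ n p * r / n) * (r / n) := by
        field_simp
    _ ≤ _ := mul_le_of_le_one_right (by positivity) ((div_le_one hn0).2 hrn')

end Costs

/-! ### The rounds of an execution -/

variable {V : Type u} [Finite V]

theorem IsQSSG.inv_pow_le_gain {G : SSG V} {q : ℕ} (hG : G.IsQSSG q) {A : Set (V × V)}
    {σ σ' : G.MaxStrategy} (h : G.ImprovesIn A σ' σ) {x y : V}
    (hxy : G.strategyValue σ x < G.strategyValue σ y)
    (hyx : G.strategyValue σ' y ≤ G.strategyValue σ' x) :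
    ((q : ℝ) ^ G.numRandom)⁻¹ ≤ G.strategyValue σ' x - G.strategyValue σ x := by
  have h1 := hG.inv_pow_le_sub σ hxy
  have h2 := h.strategyValue_le y
  linarith

/-- At a switch to a better successor, the strict comparison between the vertex and that successor
turns into an equality for `σ'`. -/
theorem IsQSSG.exists_maxV_gain {G : SSG V} {q : ℕ} (hG : G.IsQSSG q) {A : Set (V × V)}
    {σ σ' : G.MaxStrategy} (h : G.ImprovesIn A σ' σ) :
    ∃ x, G.kind x = .maxV ∧
      ((q : ℝ) ^ G.numRandom)⁻¹ ≤ G.strategyValue σ' x - G.strategyValue σ x := by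
  obtain ⟨x, hx, hlt⟩ := h.exists_gain
  exact ⟨x, hx, hG.inv_pow_le_gain h hlt (G.strategyValue_maxV σ' hx).ge⟩

/-- The number of rounds is at most `n q ^ r`. -/
theorem Execution.length_le {G : SSG V} {N : ℕ} (E : G.Execution N) {q : ℕ} (hq : 1 ≤ q)
    (hG : G.IsQSSG q) : (N : ℝ) ≤ G.numMax * (q : ℝ) ^ G.numRandom := by
  classical
  have := Fintype.ofFinite V
  have hP : (0 : ℝ) < (q : ℝ) ^ G.numRandom := by positivity
  have h := sum_card_gain_mul_le {x | G.kind x = .maxV} (fun i => G.strategyValue (E.σ i)) N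
    ((q : ℝ) ^ G.numRandom)⁻¹ (fun i hi => (E.improves i hi).strategyValue_le)
    (fun i => G.strategyValue_mem _)
  rw [← Fintype.card_subtype, ← Nat.card_eq_fintype_card, ← div_eq_mul_inv, div_le_iff₀ hP] at h
  refine le_trans ?_ h
  calc (N : ℝ) = ∑ i ∈ Finset.range N, (1 : ℝ) := by simp
    _ ≤ _ := by
      refine Finset.sum_le_sum fun i hi => ?_
      obtain ⟨x, hx, hg⟩ := hG.exists_maxV_gain (E.improves i (Finset.mem_range.1 hi))
      rw [Nat.one_le_cast, Nat.one_le_iff_ne_zero, Finset.card_ne_zero]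
      exact ⟨x, by simpa using ⟨hx, hg⟩⟩

open Classical in
/-- A round whose candidate fails splits a class of equal values, unless some random vertex has a
large gain. -/
theorem card_image_add_le [Fintype V] {G : SSG V} {q : ℕ} (hq : 1 ≤ q) (hG : G.IsQSSG q)
    {A : Set (V × V)} {σ σ' : G.MaxStrategy} (h : G.ImprovesIn A σ' σ) {τ : G.MinStrategy}
    (hτ : G.IsOrderResponse (G.strategyValue σ) σ' τ) :
    (Finset.image (G.strategyValue σ) {x | G.IsStop x}).card +
        (if G.IsBestResponse σ' τ then 0 else 1) ≤
      (Finset.image (G.strategyValue σ') {x | G.IsStop x}).card +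
        2 * (Finset.card {x ∈ ({x | G.kind x = .random} : Finset V) |
          ((q : ℝ) ^ G.numRandom)⁻¹ ≤ G.strategyValue σ' x - G.strategyValue σ x}) := by
  set δ : ℝ := ((q : ℝ) ^ G.numRandom)⁻¹ with hδ
  have hδ0 : 0 < δ := by positivity
  set v := G.strategyValue σ
  set v' := G.strategyValue σ'
  set B : Finset V := {x ∈ ({x | G.kind x = .random} : Finset V) | δ ≤ v' x - v x} with hB
  set T : Finset V := {x | G.IsStop x} with hT
  have hlt : ∀ x ∈ T \ B, ∀ y, v x < v y → v' x < v' y := by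
    intro x hx y hxy
    by_contra! hyx
    have hg : δ ≤ v' x - v x := hG.inv_pow_le_gain h hxy hyx
    rw [Finset.mem_sdiff] at hx
    rcases (Finset.mem_filter.1 hx.1).2 with hr | hs
    · exact hx.2 (by simp [hB, hr, hg])
    · have : v' x = v x := (G.strategyValue_sink σ' hs).trans (G.strategyValue_sink σ hs).symm
      linarith
  have hinj : ∀ x ∈ T \ B, ∀ y ∈ T \ B, v' x = v' y → v x = v y := by
    intro x hx y hy hxy
    rcases lt_trichotomy (v x) (v y) with hlt' | heq | hgt
    · exact absurd hxy (hlt x hx y hlt').ne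
    · exact heq
    · exact absurd hxy (hlt y hy x hgt).ne'
  -- Off `B` no strict comparison is lost, so classes there can only split; `B` accounts for at most
  -- `B.card` vanished values.
  have hle : (T.image v).card ≤ (T.image v').card + B.card := by
    have h1 : T.image v ⊆ (T \ B).image v ∪ B.image v := by
      rw [← Finset.image_union, Finset.sdiff_union_self_eq_union]
      exact Finset.image_subset_image Finset.subset_union_left
    calc (T.image v).card ≤ ((T \ B).image v).card + (B.image v).card :=
          (Finset.card_le_card h1).trans (Finset.card_union_le _ _)
      _ ≤ ((T \ B).image v').card + B.card :=
          add_le_add (Finset.card_image_le_card_image hinj) Finset.card_image_le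
      _ ≤ _ := Nat.add_le_add_right
          (Finset.card_le_card (Finset.image_subset_image Finset.sdiff_subset)) _
  split_ifs with hbest
  · omega
  -- If `B` is nonempty, its second copy in the bound pays for the failure. If it is empty, the
  -- order must have changed by breaking a tie, which adds a value.
  · rcases B.eq_empty_or_nonempty with hemp | hne
    · rw [hemp, Finset.sdiff_empty] at hlt hinj
      obtain ⟨⟨s₀, s₁, h₀, -, hs⟩, -⟩ := hG
      have hex : ∃ x y, G.IsStop x ∧ G.IsStop y ∧ ¬ (v x < v y ↔ v' x < v' y) := by
        by_contra! hiff
        exact hbest (hτ.isBestResponse ((hs s₀).2 (Or.inl rfl)) h₀ hiff)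
      obtain ⟨x, y, hx, hy, hxy⟩ := hex
      have hxT : x ∈ T := by simpa [hT] using hx
      have hyT : y ∈ T := by simpa [hT] using hy
      have hcard : (T.image v).card < (T.image v').card := by
        rcases lt_trichotomy (v x) (v y) with hlt' | heq | hgt
        · exact absurd (iff_of_true hlt' (hlt x hxT y hlt')) hxy
        · refine Finset.card_image_lt_card_image hinj hxT hyT heq fun heq' => hxy ?_
          rw [heq, heq']
          simp only [lt_self_iff_false]
        · exact absurd (iff_of_false hgt.not_gt (hlt y hyT x hgt).not_gt) hxy
      omega
    · have := hne.card_pos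
      omega

open Classical in
/-- The number of rounds whose candidate fails is at most `5 r q ^ r`. -/
theorem Execution.sum_failed_le {G : SSG V} {N : ℕ} (E : G.Execution N) {q : ℕ} (hq : 1 ≤ q)
    (hG : G.IsQSSG q) (hr : 1 ≤ G.numRandom) :
    (∑ i ∈ Finset.range N, if G.IsBestResponse (E.σ (i + 1)) (E.candidate i) then (0 : ℝ) else 1) ≤
      5 * (G.numRandom * (q : ℝ) ^ G.numRandom) := by
  have := Fintype.ofFinite V
  have hP : (1 : ℝ) ≤ (q : ℝ) ^ G.numRandom := one_le_pow₀ (by exact_mod_cast hq)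
  have hP0 : (0 : ℝ) < (q : ℝ) ^ G.numRandom := by positivity
  let Φ : ℕ → ℝ := fun i => (Finset.image (G.strategyValue (E.σ i)) {x | G.IsStop x}).card
  let b : ℕ → ℝ := fun i => (Finset.card {x ∈ ({x | G.kind x = .random} : Finset V) |
    ((q : ℝ) ^ G.numRandom)⁻¹ ≤ G.strategyValue (E.σ (i + 1)) x - G.strategyValue (E.σ i) x} : ℝ)
  have hrand : (Finset.card ({x | G.kind x = .random} : Finset V) : ℝ) = G.numRandom := by
    rw [← Fintype.card_subtype, ← Nat.card_eq_fintype_card, numRandom]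
  have hb : ∑ i ∈ Finset.range N, b i ≤ G.numRandom * (q : ℝ) ^ G.numRandom := by
    have h := sum_card_gain_mul_le {x | G.kind x = .random} (fun i => G.strategyValue (E.σ i)) N
      ((q : ℝ) ^ G.numRandom)⁻¹ (fun i hi => (E.improves i hi).strategyValue_le)
      (fun i => G.strategyValue_mem _)
    rwa [hrand, ← div_eq_mul_inv, div_le_iff₀ hP0] at h
  have hΦ : Φ N ≤ G.numRandom + 2 := by
    obtain ⟨⟨s₀, s₁, -, -, hs⟩, -⟩ := hG
    have hsub : ({x | G.IsStop x} : Finset V) ⊆ ({x | G.kind x = .random} : Finset V) ∪ {s₀, s₁} := by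
      intro x hx
      rcases (Finset.mem_filter.1 hx).2 with h | h
      · exact Finset.mem_union_left _ (by simpa using h)
      · exact Finset.mem_union_right _ (by simpa using (hs x).1 h)
    have h1 : (Finset.image (G.strategyValue (E.σ N)) {x | G.IsStop x}).card ≤
        ({x | G.kind x = .random} : Finset V).card + 2 :=
      (Finset.card_image_le.trans (Finset.card_le_card hsub)).trans
        ((Finset.card_union_le _ _).trans (Nat.add_le_add_left Finset.card_le_two _))
    rw [← hrand]
    have h2 := (Nat.cast_le (α := ℝ)).2 h1
    push_cast at h2
    exact h2
  have hround : ∀ i ∈ Finset.range N,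
      (if G.IsBestResponse (E.σ (i + 1)) (E.candidate i) then (0 : ℝ) else 1) ≤
        (Φ (i + 1) - Φ i) + 2 * b i := by
    intro i hi
    have hi := Finset.mem_range.1 hi
    have h : Φ i + (if G.IsBestResponse (E.σ (i + 1)) (E.candidate i) then (0 : ℝ) else 1) ≤
        Φ (i + 1) + 2 * b i := by
      have h := card_image_add_le hq hG (E.improves i hi) (E.orderResponse i hi)
      have h' := (Nat.cast_le (α := ℝ)).2 h
      push_cast at h'
      exact h'
    linarith
  have hsum := Finset.sum_le_sum hround
  rw [Finset.sum_add_distrib, Finset.sum_range_sub, ← Finset.mul_sum] at hsum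
  have hΦ0 : 0 ≤ Φ 0 := Nat.cast_nonneg _
  have hr' : (1 : ℝ) ≤ G.numRandom := by exact_mod_cast hr
  have hrP : (G.numRandom : ℝ) ≤ G.numRandom * (q : ℝ) ^ G.numRandom :=
    le_mul_of_one_le_right (by positivity) hP
  -- The potential contributes at most `r + 2 ≤ 3 r`, and the large gains contribute twice `r q ^
  -- r`.
  linarith

/-! ### The cost of an execution -/

/-- In the constant, 6 is one initial evaluation plus five per `r q ^ r` for the failures; `c` pays
for the improvements, and `3 c₀ κ` for ordering (twice) and evaluating the candidate (once). -/
theorem Execution.totalCost_le {G : SSG V} {N : ℕ} (E : G.Execution N) {q : ℕ} (hq : 1 ≤ q)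
    (hG : G.IsQSSG q) (hn : 1 ≤ G.numMax) (hr : 1 ≤ G.numRandom) {C : Costs} {c κ : ℝ} (hc₀ : 0 < C.c₀)
    (hc : 0 < c) (hκ : 0 < κ) (hC₂ : C.CheapImprovement c) (hC₁ : C.AtLeastQuadratic κ) :
    E.totalCost C q ≤ (6 + c + 3 * C.c₀ * κ) * ((G.numRandom : ℝ) * (q : ℝ) ^ G.numRandom *
      C.C₁ G.numMax (q ^ G.numRandom)) := by
  classical
  have hlen := E.length_le hq hG
  have hfail := E.sum_failed_le hq hG hr
  have hp : 1 ≤ q ^ G.numRandom := Nat.one_le_pow _ _ hq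
  have hP : (1 : ℝ) ≤ (q : ℝ) ^ G.numRandom := one_le_pow₀ (by exact_mod_cast hq)
  have hCpos := hC₁.pos hκ hn hp
  have h2 := hC₂ G.numMax G.numRandom q hn hr hq
  have hn0 : (1 : ℝ) ≤ G.numMax := by exact_mod_cast hn
  have hr0 : (1 : ℝ) ≤ G.numRandom := by exact_mod_cast hr
  unfold totalCost updateCost Costs.pair
  generalize hnn : G.numMax = n at *
  generalize hrr : G.numRandom = r at *
  set P : ℝ := (q : ℝ) ^ r
  set D := C.C₁ n (q ^ r)
  set X := D * r / n with hX
  have hX0 : 0 < X := by positivity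
  -- The factor `n` in the number of rounds cancels the `1 / n` in the price `X` of a round.
  have hNX : N * X ≤ r * P * D := by
    calc (N : ℝ) * X ≤ n * P * X := mul_le_mul_of_nonneg_right hlen hX0.le
      _ = r * P * D := by rw [hX]; field_simp
  have hD1 : D ≤ r * P * D := le_mul_of_one_le_left hCpos.le (one_le_mul_of_one_le_of_one_le hr0 hP)
  have hck : 0 < C.c₀ * κ := mul_pos hc₀ hκ
  have hY : 0 < r * P * D := hCpos.trans_le hD1
  have hckY : 0 < C.c₀ * κ * (r * P * D) := mul_pos hck hY
  have hcX := mul_le_mul_of_nonneg_left hNX hc.le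
  have hckX := mul_le_mul_of_nonneg_left hNX hck.le
  by_cases hrn : r < n
  · simp only [if_pos hrn]
    have hord := hC₁.order_le hc₀ hr hrn.le hp
    have hpair := mul_le_mul_of_nonneg_left (hC₁.C₁_le hκ hr hrn.le hp) hc₀.le
    have hsum : ∑ i ∈ Finset.range N, (C.C₂ n r q + (C.order n r + C.c₀ * C.C₁ r (q ^ r) +
        if G.IsBestResponse (E.σ (i + 1)) (E.candidate i) then 0 else D)) ≤
        N * ((c + 3 * (C.c₀ * κ)) * X) + 5 * (r * P) * D := by
      calc _ ≤ ∑ i ∈ Finset.range N, ((c + 3 * (C.c₀ * κ)) * X +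
            (if G.IsBestResponse (E.σ (i + 1)) (E.candidate i) then (0 : ℝ) else 1) * D) := by
            refine Finset.sum_le_sum fun i _ => ?_
            rw [ite_mul, zero_mul, one_mul, ← add_assoc]
            refine add_le_add ?_ le_rfl
            linarith
        _ ≤ _ := by
            rw [Finset.sum_add_distrib, Finset.sum_const, Finset.card_range, nsmul_eq_mul,
              ← Finset.sum_mul]
            exact add_le_add le_rfl (mul_le_mul_of_nonneg_right hfail hCpos.le)
    linarith
  · simp only [if_neg hrn, Finset.sum_const, Finset.card_range, nsmul_eq_mul]
    have hnr : (n : ℝ) ≤ r := by exact_mod_cast not_lt.1 hrn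
    have hND : N * D ≤ r * P * D := mul_le_mul_of_nonneg_right
      (hlen.trans (mul_le_mul_of_nonneg_right hnr (by linarith))) hCpos.le
    have hNC := mul_le_mul_of_nonneg_left h2 (Nat.cast_nonneg (α := ℝ) N)
    linarith

end SSG

theorem mainTheorem7 (c₀ c κ : ℝ) (hc₀ : 0 < c₀) (hc : 0 < c) (hκ : 0 < κ) :
    ∃ K : ℝ, 0 < K ∧
      ∀ C : SSG.Costs, C.c₀ = c₀ → C.CheapImprovement c → C.AtLeastQuadratic κ →
      ∀ (V : Type u) [Finite V] (G : SSG V) (q : ℕ), 1 ≤ q → G.IsQSSG q →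
        1 ≤ G.numMax → 1 ≤ G.numRandom →
        (∀ (N : ℕ) (E : G.Execution N),
          E.totalCost C q ≤
            K * ((G.numRandom : ℝ) * (q : ℝ) ^ G.numRandom *
              C.C₁ G.numMax (q ^ G.numRandom))) ∧
        (∀ (A : Set (V × V)) (σ σ' : G.MaxStrategy), A ⊆ G.arcs → G.ImprovesIn A σ' σ →
          ∀ x y : V, G.kind x = .random → G.kind y = .random →
            G.strategyValue σ x < G.strategyValue σ y →
            G.strategyValue σ' y ≤ G.strategyValue σ' x →
            ((q : ℝ) ^ G.numRandom)⁻¹ ≤ G.strategyValue σ' x - G.strategyValue σ x) := by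
  refine ⟨6 + c + 3 * c₀ * κ, by positivity, ?_⟩
  rintro C rfl hC₂ hC₁ V _ G q hq hG hn hr
  exact ⟨fun N E => E.totalCost_le hq hG hn hr hc₀ hc hκ hC₂ hC₁,
    fun A σ σ' _ h x y _ _ hxy hyx => hG.inv_pow_le_gain h hxy hyx⟩
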